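/- Let $p$ be an odd prime and let $k \ge 1$ be an integer. Let $F$ be the free pro-$p$ group on two generators $x, y$. Write $[a,b] = a^{-1}b^{-1}ab$, $a^b = b^{-1}ab$ and $y_i = y^{x^i}$ (so $y_0 = y$); longer commutators are left-normed, and $[y,x,\overset{n}{\ldots},x]$ has $n$ entries $x$. Let $R_k$ be the closed normal subgroup of $F$ generated, as a closed normal subgroup, by $x^{p^k}$, $y^p$ and the commutators $[y_0,y_i]$ for $1 \le i \le \frac{p^k-1}{2}$ (so that $F/R_k$ is the wreath product $C_p \wr C_{p^k}$). Let $N_k = [R_k,F]\,R_k^{\,p}$ (the closed subgroup of $F$ generated by all commutators $[r,f]$ with $r \in R_k$, $f \in F$ and all $p$th powers $r^p$ with $r \in R_k$), and put $G_k = F/N_k$; denote the images of $x,y$ in $G_k$ again by $x,y$. Let $\gamma_1(G_k) = G_k$ and $\gamma_{i+1}(G_k) = [\gamma_i(G_k),G_k]$ be the lower central series, and let $C_n$ denote the cyclic group of order $n$. Then $G_k$ is nilpotent of class exactly $p^k$; its lower central series satisfies \[ G_k = \gamma_1(G_k) = \langle x,y\rangle\,\gamma_2(G_k) \quad\text{with}\quad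 G_k/\gamma_2(G_k) \cong C_{p^{k+1}} \times C_{p^2}, \] and, for $1 \le i \le \frac{p^k-1}{2}$, \[ \gamma_{2i}(G_k) = \langle [y,x,\overset{2i-1}{\ldots},x]\rangle\,\gamma_{2i+1}(G_k), \qquad \gamma_{2i+1}(G_k) = \langle [y,x,\overset{2i}{\ldots},x],\ [y,x,\overset{2i-1}{\ldots},x,y]\rangle\,\gamma_{2i+2}(G_k) \] with \[ \gamma_{2i}(G_k)/\gamma_{2i+1}(G_k) \cong C_p \quad\text{and}\quad \gamma_{2i+1}(G_k)/\gamma_{2i+2}(G_k) \cong C_p \times C_p . \] -/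

import Mathlib

noncomputable section

namespace HausdorffSpectra

/-! ### The free pro-`p` group on two generators

It is built as the pro-`p` completion of the free group on two letters, i.e. as the inverse limit
of all quotients of that free group by normal subgroups of `p`-power index. -/

/-- The normal subgroups of `p`-power index of the (abstract) free group on two letters. -/
def PIndexNormal (p : ℕ) : Type :=
  {N : Subgroup (FreeGroup (Fin 2)) // N.Normal ∧ ∃ n : ℕ, N.index = p ^ n}

instance (p : ℕ) (N : PIndexNormal p) : N.1.Normal := N.2.1

/-- The finite `p`-group `FreeGroup (Fin 2) / N`, to be regarded as a discrete group. -/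
def PQuot (p : ℕ) (N : PIndexNormal p) : Type := FreeGroup (Fin 2) ⧸ N.1

instance (p : ℕ) (N : PIndexNormal p) : Group (PQuot p N) :=
  inferInstanceAs (Group (FreeGroup (Fin 2) ⧸ N.1))

instance (p : ℕ) (N : PIndexNormal p) : TopologicalSpace (PQuot p N) := ⊥

instance (p : ℕ) (N : PIndexNormal p) : DiscreteTopology (PQuot p N) := ⟨rfl⟩

/-- The natural projection `FreeGroup (Fin 2) → FreeGroup (Fin 2) / N`. -/
def PQuot.mk (p : ℕ) (N : PIndexNormal p) : FreeGroup (Fin 2) →* PQuot p N :=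
  QuotientGroup.mk' N.1

/-- The natural projection `FreeGroup (Fin 2) / N → FreeGroup (Fin 2) / M` for `N ≤ M`. -/
def PQuot.transition (p : ℕ) (N M : PIndexNormal p) (h : N.1 ≤ M.1) : PQuot p N →* PQuot p M :=
  QuotientGroup.map N.1 M.1 (MonoidHom.id _) h

/-- The free pro-`p` group on two generators: compatible families in the product of the finite
`p`-quotients of the free group on two letters. Its topology is the subspace topology of the
product topology (of discrete spaces), and it comes with the usual group structure. -/
abbrev FreeProP (p : ℕ) : Type :=
  ({ carrier := {f | ∀ (N M : PIndexNormal p) (h : N.1 ≤ M.1),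
        PQuot.transition p N M h (f N) = f M}
     mul_mem' := by
        intro f g hf hg N M h
        simp [hf N M h, hg N M h]
     one_mem' := by
        intro N M h
        simp
     inv_mem' := by
        intro f hf N M h
        simp [hf N M h] } : Subgroup ((N : PIndexNormal p) → PQuot p N))

/-- The image of an element of the abstract free group in the free pro-`p` group. -/
def FreeProP.ofFree (p : ℕ) (w : FreeGroup (Fin 2)) : FreeProP p :=
  ⟨fun N => PQuot.mk p N w, fun _ _ _ => rfl⟩

/-- The first free generator `x`. -/
def FreeProP.x (p : ℕ) : FreeProP p := FreeProP.ofFree p (FreeGroup.of 0)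

/-- The second free generator `y`. -/
def FreeProP.y (p : ℕ) : FreeProP p := FreeProP.ofFree p (FreeGroup.of 1)

/-! ### Commutators and the lower central series -/

section Groups

variable {G : Type*} [Group G]

/-- The commutator `[a, b] = a⁻¹ b⁻¹ a b`. -/
def comm (a b : G) : G := a⁻¹ * b⁻¹ * a * b

/-- The left-normed commutator `[a, b, b, …, b]` with `n` entries `b`. -/
def engel (a b : G) (n : ℕ) : G := (fun g => comm g b)^[n] a

/-- The conjugate `a ^ b = b⁻¹ a b`. -/
def conj (a b : G) : G := b⁻¹ * a * b

variable (G) in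
/-- The lower central series `γ_i(G)`, numbered so that `γ_1(G) = G` and
`γ_{i+1}(G) = [γ_i(G), G]`. It is only used for `i ≥ 1`. -/
abbrev gamma (i : ℕ) : Subgroup G := (⊤ : Subgroup G).lowerCentralSeries (i - 1)

variable (G) in
/-- The factor `γ_i(G) / γ_{i+1}(G)` of the lower central series (for `i ≥ 1`). -/
abbrev gammaFactor (i : ℕ) : Type _ := gamma G i ⧸ (gamma G (i + 1)).subgroupOf (gamma G i)

/-- The subgroup `K ^ n` generated by the `n`-th powers of the elements of `K`. -/
def powSubgroup (K : Subgroup G) (n : ℕ) : Subgroup G :=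
  Subgroup.closure {g | ∃ r ∈ K, r ^ n = g}

instance powSubgroup_normal (K : Subgroup G) [hK : K.Normal] (n : ℕ) :
    (powSubgroup K n).Normal := by
  constructor
  intro a ha g
  refine Subgroup.closure_induction (p := fun a _ => g * a * g⁻¹ ∈ powSubgroup K n)
    ?_ ?_ ?_ ?_ ha
  · rintro _ ⟨r, hr, rfl⟩
    exact Subgroup.subset_closure ⟨g * r * g⁻¹, hK.conj_mem r hr g, conj_pow⟩
  · simpa using (powSubgroup K n).one_mem
  · intro a b _ _ h1 h2
    simpa [mul_assoc] using (powSubgroup K n).mul_mem h1 h2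
  · intro a _ h
    have h2 := (powSubgroup K n).inv_mem h
    rwa [conj_inv] at h2

end Groups

/-! ### The finite groups `G_k` -/

/-- The closed normal subgroup `R_k` of the free pro-`p` group generated, as a closed normal
subgroup, by `x ^ (p ^ k)`, `y ^ p` and the commutators `[y_0, y_i]` for `1 ≤ i ≤ (p ^ k - 1) / 2`,
where `y_i = y ^ (x ^ i)`. The quotient by `R_k` is the wreath product of a cyclic group
of order `p` by a cyclic group of order `p ^ k`. -/
def R (p k : ℕ) : Subgroup (FreeProP p) :=
  (Subgroup.normalClosure
    ({FreeProP.x p ^ (p ^ k), FreeProP.y p ^ p} ∪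
      {g | ∃ i : ℕ, 1 ≤ i ∧ i ≤ (p ^ k - 1) / 2 ∧
        g = comm (FreeProP.y p) (conj (FreeProP.y p) (FreeProP.x p ^ i))})).topologicalClosure

instance R_normal (p k : ℕ) : (R p k).Normal := Subgroup.is_normal_topologicalClosure _

/-- The closed normal subgroup `N_k = [R_k, F] R_k ^ p` of the free pro-`p` group `F`. -/
def N (p k : ℕ) : Subgroup (FreeProP p) :=
  (⁅R p k, (⊤ : Subgroup (FreeProP p))⁆ ⊔ powSubgroup (R p k) p).topologicalClosure

instance N_normal (p k : ℕ) : (N p k).Normal := Subgroup.is_normal_topologicalClosure _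

/-- The group `G_k = F / N_k`. -/
abbrev Gk (p k : ℕ) : Type := FreeProP p ⧸ N p k

/-- The image of `x` in `G_k`. -/
def Gk.x (p k : ℕ) : Gk p k := QuotientGroup.mk (FreeProP.x p)

/-- The image of `y` in `G_k`. -/
def Gk.y (p k : ℕ) : Gk p k := QuotientGroup.mk (FreeProP.y p)

/-- The cyclic group `C_n` of order `n ≥ 1`, written multiplicatively. -/
abbrev Cyc (n : ℕ) : Type := Multiplicative (ZMod n)

end HausdorffSpectra

end

noncomputable section

namespace HausdorffSpectra

open scoped commutatorElement

/-! ### Commutator calculus, and recognition of products of cyclic groups. -/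

section GroupLemmas

variable {G : Type*} [Group G]

/-! In `Gk` the relators of the wreath product become central of exponent `p`; `IsCentralCover`
isolates this. Let `Z` be the central subgroup they generate and `H` the preimage of the base group,
so commutators and `p`-th powers of elements of `H` lie in `Z`. Write c_j for `engel y x j`, and
recall that `lowerCentralSeries n` is γ_{n+1}.

Upper bounds. The commutator on `H` is an alternating bilinear form with central values, invariant
under conjugation by `x` (`comm_engel_relation`). Modulo deeper terms, invariance moves an entry `x`
from one argument to the other at the cost of a sign, so [c_{2m}, y] turns into [c_m, c_m]^{±1} = 1.
This is why [c_j, y] yields a new generator only for odd j, that is, in every second factor. Baer's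
trick turns `H` into an abelian group on which `x` acts as an automorphism X with X^{p^k} = 1. Since
X - 1 is killed by `p`, it follows that (X - 1)^{p^k} = 0, whence c_{p^k} = 1 (`engel_eq_one`). As
p^k is odd, c_{p^k} alone generates its term modulo the next, and the series stops there.

Lower bounds. Over F_p, a Heisenberg group extended by a unipotent isometry is a finite `p`-group in
which the relators are central of exponent `p`, so `Gk` maps to it (`Gk.exists_lift`). The zero form
in dimension d + 1 detects c_d, and an alternating form in dimension n + 1, with n odd, detects
[c_n, y]. Unipotent matrices of size at most p^k have order dividing p^k, which accounts for the
range of indices. -/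

lemma comm_eq_commutatorElement (a b : G) : comm a b = ⁅a⁻¹, b⁻¹⁆ := by
  simp [comm, commutatorElement_def]

lemma comm_eq_one_iff {a b : G} : comm a b = 1 ↔ a * b = b * a := by
  rw [comm, mul_assoc, ← mul_inv_rev, inv_mul_eq_one, eq_comm]

lemma mul_comm_mul_comm (a b : G) : b * a * comm a b = a * b := by
  simp [comm, mul_assoc]

lemma comm_self (a : G) : comm a a = 1 := by simp [comm]

lemma comm_inv (a b : G) : (comm a b)⁻¹ = comm b a := by simp [comm, mul_assoc]

lemma comm_eq_inv_mul_conj (a b : G) : comm a b = a⁻¹ * conj a b := by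
  simp [comm, conj, mul_assoc]

lemma map_comm {K : Type*} [Group K] (f : G →* K) (a b : G) : f (comm a b) = comm (f a) (f b) := by
  simp [comm]

lemma map_conj {K : Type*} [Group K] (f : G →* K) (a b : G) : f (conj a b) = conj (f a) (f b) := by
  simp [conj]

lemma engel_succ (a b : G) (n : ℕ) : engel a b (n + 1) = comm (engel a b n) b := by
  rw [engel, Function.iterate_succ_apply']; rfl

lemma map_engel {K : Type*} [Group K] (f : G →* K) (a b : G) (n : ℕ) :
    f (engel a b n) = engel (f a) (f b) n := by
  induction n with
  | zero => rfl
  | succ n ih => rw [engel_succ, engel_succ, map_comm, ih]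

lemma conj_comm (a b g : G) : conj (comm a b) g = comm (conj a g) (conj b g) := by
  simp [conj, comm, mul_assoc]

lemma conj_conj (a g h : G) : conj (conj a g) h = conj a (g * h) := by
  simp [conj, mul_assoc]

lemma conj_eq_self_of_mem_center {a : G} (ha : a ∈ Subgroup.center G) (g : G) : conj a g = a := by
  rw [conj, mul_assoc, ← Subgroup.mem_center_iff.1 ha, inv_mul_cancel_left]

lemma comm_eq_one_of_mem_center {a : G} (ha : a ∈ Subgroup.center G) (g : G) : comm a g = 1 := by
  rw [comm_eq_inv_mul_conj, conj_eq_self_of_mem_center ha, inv_mul_cancel]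

lemma comm_mul_left_of_mem_center {a b c : G} (h : comm a c ∈ Subgroup.center G) :
    comm (a * b) c = comm a c * comm b c := by
  have : comm (a * b) c = conj (comm a c) b * comm b c := by simp [comm, conj, mul_assoc]
  rw [this, conj_eq_self_of_mem_center h]

lemma comm_mul_right_of_mem_center {a b c : G} (h : comm a b ∈ Subgroup.center G) :
    comm a (b * c) = comm a b * comm a c := by
  have : comm a (b * c) = comm a c * conj (comm a b) c := by simp [comm, conj, mul_assoc]
  rw [this, conj_eq_self_of_mem_center h, Subgroup.mem_center_iff.1 h]

lemma comm_mem_lowerCentralSeries {n : ℕ} {a : G}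
    (ha : a ∈ (⊤ : Subgroup G).lowerCentralSeries n) (b : G) :
    comm a b ∈ (⊤ : Subgroup G).lowerCentralSeries (n + 1) := by
  rw [comm_eq_commutatorElement, Subgroup.lowerCentralSeries_succ]
  exact Subgroup.commutator_mem_commutator (inv_mem ha) (Subgroup.mem_top _)

lemma engel_mem_lowerCentralSeries (a b : G) (n : ℕ) :
    engel a b n ∈ (⊤ : Subgroup G).lowerCentralSeries n := by
  induction n with
  | zero => trivial
  | succ n ih => rw [engel_succ]; exact comm_mem_lowerCentralSeries ih b

lemma mul_comm_of_mem_closure {S T : Set G} (h : ∀ s ∈ S, ∀ t ∈ T, s * t = t * s) :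
    ∀ s ∈ Subgroup.closure S, ∀ t ∈ Subgroup.closure T, s * t = t * s := by
  have h1 : Subgroup.closure S ≤ Subgroup.centralizer T :=
    (Subgroup.closure_le _).2 fun s hs => Subgroup.mem_centralizer_iff.2 fun t ht => (h s hs t ht).symm
  have h2 : Subgroup.closure T ≤ Subgroup.centralizer (Subgroup.closure S : Set G) :=
    (Subgroup.closure_le _).2 fun t ht => Subgroup.mem_centralizer_iff.2 fun s hs =>
      (Subgroup.mem_centralizer_iff.1 (h1 hs) t ht).symm
  intro s hs t ht
  exact Subgroup.mem_centralizer_iff.1 (h2 ht) s hs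

/-- If `γ_n` is generated by `S` modulo `γ_{n+1}` and `G` is generated by `T`, then `γ_{n+1}` is
generated by the commutators `[s, t]` modulo `γ_{n+2}`. -/
lemma lowerCentralSeries_succ_eq_of_eq {n : ℕ} {S T U : Set G} (hT : Subgroup.closure T = ⊤)
    (hS : (⊤ : Subgroup G).lowerCentralSeries n =
      Subgroup.closure S ⊔ (⊤ : Subgroup G).lowerCentralSeries (n + 1))
    (hU : U ⊆ (⊤ : Subgroup G).lowerCentralSeries (n + 1))
    (hST : ∀ s ∈ S, ∀ t ∈ T, comm s t ∈
      Subgroup.closure U ⊔ (⊤ : Subgroup G).lowerCentralSeries (n + 2)) :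
    (⊤ : Subgroup G).lowerCentralSeries (n + 1) =
      Subgroup.closure U ⊔ (⊤ : Subgroup G).lowerCentralSeries (n + 2) := by
  set K := Subgroup.closure U ⊔ (⊤ : Subgroup G).lowerCentralSeries (n + 2) with hK
  have hle : K ≤ (⊤ : Subgroup G).lowerCentralSeries (n + 1) :=
    sup_le ((Subgroup.closure_le _).2 hU) (Subgroup.lowerCentralSeries_antitone _ (Nat.le_succ _))
  have hcomm : ∀ a ∈ (⊤ : Subgroup G).lowerCentralSeries (n + 1), ∀ g : G, comm a g ∈ K :=
    fun a ha g => (le_sup_right : _ ≤ K) (comm_mem_lowerCentralSeries ha g)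
  -- Conjugation changes an element of `K` by a commutator from the next term, which lies in `K`.
  have hnormal : K.Normal := ⟨fun a ha g => by
    have : g * a * g⁻¹ = a * comm a g⁻¹ := by simp [comm, mul_assoc]
    rw [this]
    exact mul_mem ha (hcomm a (hle ha) _)⟩
  refine le_antisymm ?_ hle
  rw [Subgroup.lowerCentralSeries_succ, Subgroup.commutator_le]
  intro a ha g _
  let q := QuotientGroup.mk' K
  have hq : ∀ u v : G, q u * q v = q v * q u ↔ comm u v ∈ K := fun u v => by
    rw [← comm_eq_one_iff, ← map_comm]; exact QuotientGroup.eq_one_iff _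
  rw [← QuotientGroup.eq_one_iff (N := K)]
  change q _ = 1
  rw [map_commutatorElement, commutatorElement_eq_one_iff_mul_comm]
  -- Modulo `K`, both `S` and the term n + 1 commute with the generators `T`, hence so do the
  -- subgroups generated.
  have key := mul_comm_of_mem_closure
    (S := q '' (S ∪ (⊤ : Subgroup G).lowerCentralSeries (n + 1))) (T := q '' T) (by
      rintro _ ⟨s, hs, rfl⟩ _ ⟨t, ht, rfl⟩
      rw [hq]
      rcases hs with hs | hs
      · exact hST s hs t ht
      · exact hcomm s hs t)
  refine key _ ?_ _ ?_
  · rw [← MonoidHom.map_closure, Subgroup.closure_union, Subgroup.closure_eq, ← hS]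
    exact Subgroup.mem_map_of_mem _ ha
  · rw [← MonoidHom.map_closure, hT]
    exact Subgroup.mem_map_of_mem _ trivial

/-- A finitely generated torsion group with a commutative subgroup of finite index is finite. -/
lemma finite_of_fg_of_torsion [Group.FG G] (A : Subgroup G) [A.FiniteIndex]
    (hA : ∀ a ∈ A, ∀ b ∈ A, a * b = b * a) (hG : ∀ g : G, IsOfFinOrder g) : Finite G := by
  have : Group.FG A := Subgroup.fg_of_index_ne_zero A
  let _ : CommGroup A := { (inferInstance : Group A) with
    mul_comm := fun a b => Subtype.ext (hA a a.2 b b.2) }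
  have : Finite A := CommGroup.finite_of_fg_isMulTorsion A fun a =>
    Submonoid.isOfFinOrder_coe.1 (hG a)
  exact Finite.of_subgroup_quotient A

/-- A group generated by two commuting elements of orders `r` and `s` that are independent is
a product of cyclic groups. -/
lemma nonempty_mulEquiv_cyc_prod {a b : G} {r s : ℕ} (hab : a * b = b * a)
    (hgen : Subgroup.closure {a, b} = ⊤) (ha : a ^ r = 1) (hb : b ^ s = 1)
    (hind : ∀ i j : ℤ, a ^ i * b ^ j = 1 → (r : ℤ) ∣ i ∧ (s : ℤ) ∣ j) :
    Nonempty (G ≃* Cyc r × Cyc s) := by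
  let f (c : G) (n : ℕ) (hc : c ^ n = 1) : Cyc n →* G := AddMonoidHom.toMultiplicativeLeft
    (ZMod.lift n ⟨zmultiplesHom (Additive G) (Additive.ofMul c), by simp [← ofMul_pow, hc]⟩)
  have hf : ∀ (c : G) (n : ℕ) (hc : c ^ n = 1) (i : ℤ),
      f c n hc (Multiplicative.ofAdd (i : ZMod n)) = c ^ i := by
    intro c n hc i
    simp [f]
  let F : Cyc r × Cyc s →* G := (f a r ha).noncommCoprod (f b s hb) (by
    intro m n
    obtain ⟨i, hi⟩ := ZMod.intCast_surjective m.toAdd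
    obtain ⟨j, hj⟩ := ZMod.intCast_surjective n.toAdd
    rw [← ofAdd_toAdd m, ← ofAdd_toAdd n, ← hi, ← hj, hf a r ha, hf b s hb]
    exact Commute.zpow_zpow hab i j)
  have hF : ∀ i j : ℤ, F (Multiplicative.ofAdd (i : ZMod r), Multiplicative.ofAdd (j : ZMod s)) =
      a ^ i * b ^ j := by
    intro i j
    rw [MonoidHom.noncommCoprod_apply, hf a r ha, hf b s hb]
  refine ⟨(MulEquiv.ofBijective F ⟨?_, ?_⟩).symm⟩
  · rw [injective_iff_map_eq_one]
    rintro ⟨m, n⟩ h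
    obtain ⟨i, hi⟩ := ZMod.intCast_surjective m.toAdd
    obtain ⟨j, hj⟩ := ZMod.intCast_surjective n.toAdd
    rw [← ofAdd_toAdd m, ← ofAdd_toAdd n, ← hi, ← hj] at h ⊢
    rw [hF] at h
    obtain ⟨h1, h2⟩ := hind i j h
    rw [(ZMod.intCast_zmod_eq_zero_iff_dvd _ _).2 h1, (ZMod.intCast_zmod_eq_zero_iff_dvd _ _).2 h2]
    rfl
  · rw [← MonoidHom.range_eq_top, eq_top_iff, ← hgen, Subgroup.closure_le]
    rintro c (rfl | rfl)
    · exact ⟨_, by simpa using hF 1 0⟩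
    · exact ⟨_, by simpa using hF 0 1⟩

/-- A group generated by an element of order `r` is cyclic of order `r`. -/
lemma nonempty_mulEquiv_cyc {a : G} {r : ℕ} (hgen : Subgroup.closure {a} = ⊤) (ha : a ^ r = 1)
    (hind : ∀ i : ℤ, a ^ i = 1 → (r : ℤ) ∣ i) : Nonempty (G ≃* Cyc r) := by
  obtain ⟨e⟩ := nonempty_mulEquiv_cyc_prod (a := a) (b := 1) (r := r) (s := 1) (by simp)
    (by rw [eq_top_iff, ← hgen]; exact Subgroup.closure_mono (by simp)) ha (by simp)
    (fun i j h => ⟨hind i (by simpa using h), one_dvd j⟩)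
  exact ⟨e.trans ⟨⟨fun c => c.1, fun c => (c, 1), fun c => Prod.ext rfl (Subsingleton.elim _ _),
    fun c => rfl⟩, fun _ _ => rfl⟩⟩

end GroupLemmas

/-! ### Quotients of the wreath product and their central covers. -/

section Upper

/-- The relators of the wreath product `C_p ≀ C_{p ^ k}`. -/
def relators (p k : ℕ) {G : Type*} [Group G] (x y : G) : Set G :=
  {x ^ (p ^ k), y ^ p} ∪
    {g | ∃ i : ℕ, 1 ≤ i ∧ i ≤ (p ^ k - 1) / 2 ∧ g = comm y (conj y (x ^ i))}

lemma image_relators (p k : ℕ) {G K : Type*} [Group G] [Group K] (f : G →* K) (x y : G) :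
    f '' relators p k x y = relators p k (f x) (f y) := by
  ext g
  constructor
  · rintro ⟨_, (rfl | rfl) | ⟨i, h1, h2, rfl⟩, rfl⟩
    · exact Or.inl (Or.inl (map_pow f _ _))
    · exact Or.inl (Or.inr (map_pow f _ _))
    · exact Or.inr ⟨i, h1, h2, by rw [map_comm, map_conj, map_pow]⟩
  · rintro ((rfl | rfl) | ⟨i, h1, h2, rfl⟩)
    · exact ⟨_, Or.inl (Or.inl rfl), map_pow f _ _⟩
    · exact ⟨_, Or.inl (Or.inr rfl), map_pow f _ _⟩
    · exact ⟨_, Or.inr ⟨i, h1, h2, rfl⟩, by rw [map_comm, map_conj, map_pow]⟩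

/-- `G` is generated by `x` and `y`, and satisfies the defining relations of `C_p ≀ C_{p ^ k}`. -/
structure IsWreathQuotient (p k : ℕ) {G : Type*} [Group G] (x y : G) : Prop where
  closure_eq : Subgroup.closure {x, y} = ⊤
  eq_one : ∀ r ∈ relators p k x y, r = 1

/-- `G` is generated by `x` and `y`, and the relators of `C_p ≀ C_{p ^ k}` are central elements
of `G` whose order divides `p`. -/
structure IsCentralCover (p k : ℕ) {G : Type*} [Group G] (x y : G) : Prop where
  closure_eq : Subgroup.closure {x, y} = ⊤
  mem_center : ∀ r ∈ relators p k x y, r ∈ Subgroup.center G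
  pow_eq_one : ∀ r ∈ relators p k x y, r ^ p = 1

universe u

variable {p k : ℕ} {G : Type u} [Group G] {x y : G}

namespace IsWreathQuotient

variable (h : IsWreathQuotient p k x y)
include h

lemma x_pow : x ^ (p ^ k) = 1 := h.eq_one _ (Or.inl (Or.inl rfl))

lemma y_pow : y ^ p = 1 := h.eq_one _ (Or.inl (Or.inr rfl))

lemma commute_conj_zpow (hodd : Odd p) (i : ℤ) : Commute y (conj y (x ^ i)) := by
  have hm : Odd (p ^ k) := hodd.pow
  have hm0 : (0 : ℤ) < (p ^ k : ℕ) := by exact_mod_cast hm.pos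
  have hx : x ^ i = x ^ (i % (p ^ k : ℕ)).toNat := by
    rw [← zpow_natCast, Int.toNat_of_nonneg (Int.emod_nonneg _ hm0.ne')]
    conv_lhs => rw [← Int.emod_add_mul_ediv i (p ^ k : ℕ)]
    rw [zpow_add, zpow_mul, zpow_natCast, h.x_pow, one_zpow, mul_one]
  have hlt : (i % (p ^ k : ℕ)).toNat < p ^ k := by
    have := Int.emod_lt_of_pos i hm0
    omega
  rw [hx]
  generalize (i % (p ^ k : ℕ)).toNat = r at hlt
  have aux : ∀ r : ℕ, r ≤ (p ^ k - 1) / 2 → Commute y (conj y (x ^ r)) := by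
    intro r hr
    rcases Nat.eq_zero_or_pos r with rfl | h0
    · simp [conj]
    · exact comm_eq_one_iff.1 (h.eq_one _ (Or.inr ⟨r, h0, hr, rfl⟩))
  by_cases hr : r ≤ (p ^ k - 1) / 2
  · exact aux r hr
  -- Since p^k is odd, p^k - r falls in the range of the relators; conjugating by x^r turns the pair
  -- y, y_{-r} into y_r, y.
  · have h1 := aux (p ^ k - r) (by obtain ⟨c, hc⟩ := hm; omega)
    have h2 : conj y (x ^ (p ^ k - r)) = conj y (x ^ r)⁻¹ := by
      rw [pow_sub _ hlt.le, h.x_pow, one_mul]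
    rw [h2] at h1
    have h3 := (Commute.conj_iff (x ^ r)⁻¹).2 h1
    simpa [conj, mul_assoc] using h3.symm

end IsWreathQuotient

/-- The subgroup generated by the conjugates of `y` by powers of `x`. -/
def baseSubgroup (x y : G) : Subgroup G :=
  Subgroup.closure (Set.range fun i : ℤ => conj y (x ^ i))

lemma self_mem_baseSubgroup : y ∈ baseSubgroup x y :=
  Subgroup.subset_closure ⟨0, by simp [conj]⟩

namespace IsWreathQuotient

variable (h : IsWreathQuotient p k x y)
include h

lemma normal_baseSubgroup : (baseSubgroup x y).Normal := by
  have hx : x ∈ Subgroup.normalizer (Set.range fun i : ℤ => conj y (x ^ i)) := by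
    rw [Subgroup.mem_normalizer_iff_conj_image_eq, ← Set.range_comp]
    have : (⇑(MulAut.conj x) ∘ fun i : ℤ => conj y (x ^ i)) =
        (fun i : ℤ => conj y (x ^ i)) ∘ (Equiv.subRight (1 : ℤ)) := by
      ext i
      simp [conj, zpow_sub, mul_assoc]
    rw [this, EquivLike.range_comp]
  rw [← Subgroup.normalizer_eq_top_iff, eq_top_iff, ← h.closure_eq, Subgroup.closure_le]
  rintro g (rfl | rfl)
  · exact Subgroup.normalizer_le_normalizer_closure _ hx
  · exact Subgroup.le_normalizer self_mem_baseSubgroup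

lemma mul_comm_of_mem_baseSubgroup (hodd : Odd p) :
    ∀ a ∈ baseSubgroup x y, ∀ b ∈ baseSubgroup x y, a * b = b * a := by
  apply mul_comm_of_mem_closure
  rintro _ ⟨i, rfl⟩ _ ⟨j, rfl⟩
  have h1 := (Commute.conj_iff (x ^ i)⁻¹).2 (h.commute_conj_zpow hodd (j - i))
  have h2 : Commute (conj y (x ^ i)) (conj y (x ^ j)) := by
    simpa [conj, zpow_sub, mul_assoc] using h1
  exact h2

lemma pow_eq_one_of_mem_baseSubgroup (hodd : Odd p) {a : G} (ha : a ∈ baseSubgroup x y) :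
    a ^ p = 1 := by
  refine Subgroup.closure_induction (p := fun a _ => a ^ p = 1) ?_ (one_pow p) ?_ ?_ ha
  · rintro _ ⟨i, rfl⟩
    have : conj y (x ^ i) = (x ^ i)⁻¹ * y * (x ^ i)⁻¹⁻¹ := by simp [conj]
    change conj y (x ^ i) ^ p = 1
    rw [this, conj_pow, h.y_pow]
    simp
  · intro a b ha hb h1 h2
    have hab : Commute a b := h.mul_comm_of_mem_baseSubgroup hodd a ha b hb
    rw [hab.mul_pow, h1, h2, one_mul]
  · intro a _ h1
    rw [inv_pow, h1, inv_one]

lemma exists_zpow_inv_mul_mem (g : G) : ∃ i : ℤ, (x ^ i)⁻¹ * g ∈ baseSubgroup x y := by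
  have := h.normal_baseSubgroup
  let q := QuotientGroup.mk' (baseSubgroup x y)
  have hq : Subgroup.closure {q x} = ⊤ := by
    have h1 : (Subgroup.closure {x, y}).map q = ⊤ := by
      rw [h.closure_eq, ← MonoidHom.range_eq_map, MonoidHom.range_eq_top]
      exact QuotientGroup.mk'_surjective _
    rw [eq_top_iff, ← h1, MonoidHom.map_closure, Subgroup.closure_le]
    rintro _ ⟨_, (rfl | rfl), rfl⟩
    · exact Subgroup.subset_closure rfl
    · rw [show q _ = 1 from (QuotientGroup.eq_one_iff _).2 self_mem_baseSubgroup]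
      exact one_mem _
  have hg : q g ∈ Subgroup.closure {q x} := by rw [hq]; trivial
  obtain ⟨i, hi⟩ := Subgroup.mem_closure_singleton.1 hg
  exact ⟨i, QuotientGroup.eq.1 ((map_zpow q x i).trans hi)⟩

lemma pow_mem_baseSubgroup (g : G) : g ^ (p ^ k) ∈ baseSubgroup x y := by
  have := h.normal_baseSubgroup
  obtain ⟨i, hi⟩ := h.exists_zpow_inv_mul_mem g
  rw [← QuotientGroup.eq] at hi
  rw [← QuotientGroup.eq_one_iff, QuotientGroup.mk_pow, ← hi, ← QuotientGroup.mk_pow,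
    ← zpow_natCast, zpow_comm, zpow_natCast, h.x_pow, one_zpow]
  rfl

lemma finiteIndex_baseSubgroup (hp : 0 < p) : (baseSubgroup x y).FiniteIndex := by
  have hfin : IsOfFinOrder x := isOfFinOrder_iff_pow_eq_one.2 ⟨p ^ k, by positivity, h.x_pow⟩
  have : Finite (Subgroup.zpowers x) := hfin.finite_zpowers
  have : Finite (G ⧸ baseSubgroup x y) :=
    Finite.of_surjective (fun a : Subgroup.zpowers x => (a : G ⧸ baseSubgroup x y)) (by
      intro g
      obtain ⟨g, rfl⟩ := QuotientGroup.mk_surjective g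
      obtain ⟨i, hi⟩ := h.exists_zpow_inv_mul_mem g
      exact ⟨⟨x ^ i, i, rfl⟩, QuotientGroup.eq.2 hi⟩)
  exact Subgroup.finiteIndex_of_finite_quotient

lemma pow_pow_eq_one (hodd : Odd p) (g : G) : g ^ p ^ (k + 1) = 1 := by
  rw [pow_succ, pow_mul]
  exact h.pow_eq_one_of_mem_baseSubgroup hodd (h.pow_mem_baseSubgroup g)

lemma finite (hodd : Odd p) : Finite G := by
  have := h.finiteIndex_baseSubgroup hodd.pos
  have : Group.FG G := Group.fg_iff.2 ⟨_, h.closure_eq, Set.toFinite _⟩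
  exact finite_of_fg_of_torsion (baseSubgroup x y) (h.mul_comm_of_mem_baseSubgroup hodd)
    fun g => isOfFinOrder_iff_pow_eq_one.2 ⟨_, pow_pos hodd.pos _, h.pow_pow_eq_one hodd g⟩

end IsWreathQuotient

/-- The subgroup generated by the relators. -/
def relatorSubgroup (p k : ℕ) (x y : G) : Subgroup G := Subgroup.closure (relators p k x y)

namespace IsCentralCover

variable (h : IsCentralCover p k x y)
include h

lemma relatorSubgroup_le_center : relatorSubgroup p k x y ≤ Subgroup.center G :=
  (Subgroup.closure_le _).2 h.mem_center

lemma normal_relatorSubgroup : (relatorSubgroup p k x y).Normal :=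
  ⟨fun a ha g => by
    rwa [Subgroup.mem_center_iff.1 (h.relatorSubgroup_le_center ha) g, mul_inv_cancel_right]⟩

lemma pow_eq_one_of_mem {z : G} (hz : z ∈ relatorSubgroup p k x y) : z ^ p = 1 := by
  refine Subgroup.closure_induction (p := fun a _ => a ^ p = 1) h.pow_eq_one (one_pow p) ?_ ?_ hz
  · intro a b ha hb h1 h2
    have hab : Commute a b := Subgroup.mem_center_iff.1 (h.relatorSubgroup_le_center hb) a
    rw [hab.mul_pow, h1, h2, one_mul]
  · intro a _ h1
    rw [inv_pow, h1, inv_one]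

/-- A central cover of a wreath product surjects onto a quotient of the wreath product with
kernel the subgroup generated by the relators. -/
lemma exists_hom : ∃ (Q : Type u) (_ : Group Q) (q : G →* Q), Function.Surjective q ∧
    q.ker = relatorSubgroup p k x y ∧ IsWreathQuotient p k (q x) (q y) := by
  have := h.normal_relatorSubgroup
  refine ⟨G ⧸ relatorSubgroup p k x y, inferInstance, QuotientGroup.mk' _,
    QuotientGroup.mk'_surjective _, QuotientGroup.ker_mk' _, ?_, ?_⟩
  · rw [← Set.image_pair, ← MonoidHom.map_closure, h.closure_eq, ← MonoidHom.range_eq_map,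
      MonoidHom.range_eq_top]
    exact QuotientGroup.mk'_surjective _
  · rw [← image_relators]
    rintro _ ⟨r, hr, rfl⟩
    exact (QuotientGroup.eq_one_iff _).2 (Subgroup.subset_closure hr)

/-- The inverse image of the base group of the wreath product. -/
lemma exists_base (hodd : Odd p) : ∃ H : Subgroup G, H.Normal ∧ y ∈ H ∧
    relatorSubgroup p k x y ≤ H ∧
    (∀ a ∈ H, ∀ b ∈ H, comm a b ∈ relatorSubgroup p k x y) ∧
    (∀ a ∈ H, a ^ p ∈ relatorSubgroup p k x y) := by
  obtain ⟨Q, _, q, -, hker, hQ⟩ := h.exists_hom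
  refine ⟨(baseSubgroup (q x) (q y)).comap q, hQ.normal_baseSubgroup.comap q,
    self_mem_baseSubgroup, ?_, ?_, ?_⟩
  · intro z hz
    rw [← hker, MonoidHom.mem_ker] at hz
    rw [Subgroup.mem_comap, hz]
    exact one_mem _
  · intro a ha b hb
    rw [← hker, MonoidHom.mem_ker, map_comm, comm_eq_one_iff]
    exact hQ.mul_comm_of_mem_baseSubgroup hodd _ ha _ hb
  · intro a ha
    rw [← hker, MonoidHom.mem_ker, map_pow]
    exact hQ.pow_eq_one_of_mem_baseSubgroup hodd ha

lemma pow_pow_eq_one (hodd : Odd p) (g : G) : g ^ p ^ (k + 2) = 1 := by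
  obtain ⟨Q, _, q, -, hker, hQ⟩ := h.exists_hom
  rw [pow_succ, pow_mul]
  apply h.pow_eq_one_of_mem
  rw [← hker, MonoidHom.mem_ker, map_pow, hQ.pow_pow_eq_one hodd]

/-- The relators generate a central subgroup of finite index, and `G` is a finitely generated
torsion group. -/
lemma finite (hodd : Odd p) : Finite G := by
  obtain ⟨Q, _, q, hq, hker, hQ⟩ := h.exists_hom
  have := hQ.finite hodd
  have : Group.FG G := Group.fg_iff.2 ⟨_, h.closure_eq, Set.toFinite _⟩
  have : (q.ker).FiniteIndex := Subgroup.finiteIndex_ker q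
  refine finite_of_fg_of_torsion q.ker ?_ fun g =>
    isOfFinOrder_iff_pow_eq_one.2 ⟨_, pow_pos hodd.pos _, h.pow_pow_eq_one hodd g⟩
  rw [hker]
  exact fun a _ b hb => Subgroup.mem_center_iff.1 (h.relatorSubgroup_le_center hb) a

lemma isNilpotent (hp : p.Prime) (hodd : Odd p) : Group.IsNilpotent G := by
  have := h.finite hodd
  have := Fact.mk hp
  exact IsPGroup.isNilpotent (p := p) fun g => ⟨k + 2, h.pow_pow_eq_one hodd g⟩

end IsCentralCover

end Upper

/-! ### Baer's trick for groups of class two. -/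

section Baer

variable {H : Type*} [Group H] {n : ℕ}

/-- The Baer sum `u v [u, v] ^ n` on a group of class two, whose commutators are killed
by `2 n + 1`. -/
abbrev baerAddCommGroup (hc : ∀ a b : H, comm a b ∈ Subgroup.center H)
    (hn : ∀ a b : H, comm a b ^ (2 * n + 1) = 1) : AddCommGroup H :=
  -- The exponent `n` is -1/2 modulo 2n + 1; as u v = v u [u, v], this is what makes the sum
  -- symmetric.
  letI : Add H := ⟨fun u v => u * v * comm u v ^ n⟩
  letI : Zero H := ⟨1⟩
  letI : Neg H := ⟨fun u => u⁻¹⟩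
  { AddGroup.ofLeftAxioms (G := H)
      (fun u v w => by
        change u * v * comm u v ^ n * w * comm (u * v * comm u v ^ n) w ^ n =
          u * (v * w * comm v w ^ n) * comm u (v * w * comm v w ^ n) ^ n
        have hcn : ∀ a b : H, comm a b ^ n ∈ Subgroup.center H := fun a b => pow_mem (hc a b) n
        have e1 : comm (u * v * comm u v ^ n) w = comm u w * comm v w := by
          rw [comm_mul_left_of_mem_center (hc _ _), comm_mul_left_of_mem_center (hc _ _),
            comm_eq_one_of_mem_center (hcn u v), mul_one]
        have e2 : comm u (v * w * comm v w ^ n) = comm u v * comm u w := by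
          rw [comm_mul_right_of_mem_center (hc _ _), comm_mul_right_of_mem_center (hc _ _),
            ← comm_inv (comm v w ^ n), comm_eq_one_of_mem_center (hcn v w), inv_one, mul_one]
        have hcom : ∀ a b c : H, Commute c (comm a b) :=
          fun a b c => Subgroup.mem_center_iff.1 (hc a b) c
        have hcomn : ∀ a b c : H, Commute c (comm a b ^ n) := fun a b c => (hcom a b c).pow_right n
        rw [e1, e2, (hcom v w (comm u w)).mul_pow, (hcom u w (comm u v)).mul_pow]
        calc _ = u * v * (comm u v ^ n * w) * (comm u w ^ n * comm v w ^ n) := by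
              simp only [mul_assoc]
          _ = u * v * (w * comm u v ^ n) * (comm v w ^ n * comm u w ^ n) := by
              rw [(hcomn u v w).eq, (hcomn v w (comm u w ^ n)).eq]
          _ = u * v * w * (comm u v ^ n * comm v w ^ n) * comm u w ^ n := by
              simp only [mul_assoc]
          _ = _ := by
              rw [(hcomn v w (comm u v ^ n)).eq]; simp only [mul_assoc])
      (fun u => by
        change 1 * u * comm 1 u ^ n = u
        simp [comm])
      (fun u => by
        change u⁻¹ * u * comm u⁻¹ u ^ n = 1
        simp [comm]) with
    add_comm := fun u v => by
      change u * v * comm u v ^ n = v * u * comm v u ^ n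
      have h1 : comm u v ^ (n + 1) * comm u v ^ n = 1 := by
        rw [← pow_add, ← hn u v]; congr 1; ring
      rw [← comm_inv u v, inv_pow, ← mul_comm_mul_comm u v, mul_assoc, ← pow_succ',
        eq_inv_of_mul_eq_one_left h1] }

lemma baer_nsmul (hc : ∀ a b : H, comm a b ∈ Subgroup.center H)
    (hn : ∀ a b : H, comm a b ^ (2 * n + 1) = 1) (i : ℕ) (u : H) :
    letI := baerAddCommGroup hc hn
    i • u = u ^ i := by
  let := baerAddCommGroup hc hn
  change i • u = u ^ i
  have hadd : ∀ u v : H, u + v = u * v * comm u v ^ n := fun _ _ => rfl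
  induction i with
  | zero => rw [zero_smul, pow_zero]; rfl
  | succ i ih =>
    rw [succ_nsmul, ih, hadd, comm_eq_one_iff.2 ((Commute.refl u).pow_left i).eq, one_pow,
      mul_one, pow_succ]

/-- In a group of class two whose commutators are killed by the odd number `p`, `p`-th powers
are multiplicative. -/
lemma mul_pow_of_comm_mem_center {p : ℕ} (hodd : Odd p)
    (hc : ∀ a b : H, comm a b ∈ Subgroup.center H) (hn : ∀ a b : H, comm a b ^ p = 1) {a b : H}
    (hb : b ^ p ∈ Subgroup.center H) : (a * b) ^ p = a ^ p * b ^ p := by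
  obtain ⟨n, rfl⟩ := hodd
  let := baerAddCommGroup hc hn
  have hadd : ∀ u v : H, u + v = u * v * comm u v ^ n := fun _ _ => rfl
  have hadd' : ∀ u z : H, z ∈ Subgroup.center H → u + z = u * z := fun u z hz => by
    rw [hadd, ← comm_inv, comm_eq_one_of_mem_center hz, inv_one, one_pow, mul_one]
  have hsmul := baer_nsmul hc hn
  have hz : (comm a b ^ n)⁻¹ ∈ Subgroup.center H := inv_mem (pow_mem (hc a b) n)
  have hab : a * b = a + b + (comm a b ^ n)⁻¹ := by
    rw [hadd' _ _ hz, hadd, mul_inv_cancel_right]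
  have h0 : (0 : H) = 1 := rfl
  rw [← hsmul, hab, smul_add, smul_add, hsmul, hsmul, hsmul, inv_pow, ← pow_mul, mul_comm n,
    pow_mul, hn, one_pow, inv_one, ← h0, add_zero, hadd' _ _ hb]

/-- Only p t = 0 is assumed, not p = 0, because the base may have elements of order p². Every middle
binomial term contains both `p` and `t`. -/
lemma add_one_pow_prime_pow_eq_one_imp {S : Type*} [Ring S] {p : ℕ} (hp : p.Prime) {k : ℕ} {t : S}
    (ht : (p : S) * t = 0) (h : (t + 1) ^ p ^ k = 1) : t ^ p ^ k = 0 := by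
  have h1 := (Commute.one_right t).add_pow_prime_pow_eq hp k
  rw [h, one_pow, Finset.mul_sum, Finset.sum_eq_zero, add_zero] at h1
  · simpa using h1
  · intro i hi
    rw [ht, zero_mul, zero_mul]

/-- If an automorphism `f` of order dividing `p ^ k` of a group of class two acts trivially on
commutators and `p`-th powers, then the `p ^ k`-fold iterate of `u ↦ u⁻¹ f(u)` is trivial. -/
lemma eq_one_of_pow_eq_one {p k : ℕ} (hp : p.Prime) (hodd : Odd p)
    (hc : ∀ a b : H, comm a b ∈ Subgroup.center H) (hn : ∀ a b : H, comm a b ^ p = 1)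
    (f : Monoid.End H) (hf : f ^ p ^ k = 1) (hfc : ∀ a b, f (comm a b) = comm a b)
    (hfp : ∀ a, f (a ^ p) = a ^ p) (c : ℕ → H) (hsucc : ∀ j, c (j + 1) = (c j)⁻¹ * f (c j)) :
    c (p ^ k) = 1 := by
  obtain ⟨n, rfl⟩ := hodd
  let := baerAddCommGroup hc hn
  have hadd : ∀ u v : H, u + v = u * v * comm u v ^ n := fun _ _ => rfl
  have hcn : ∀ a b : H, comm a b ^ n ∈ Subgroup.center H := fun a b => pow_mem (hc a b) n
  have hadd' : ∀ u z : H, z ∈ Subgroup.center H → u + z = u * z := fun u z hz => by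
    rw [hadd, ← comm_inv, comm_eq_one_of_mem_center hz, inv_one, one_pow, mul_one]
  have hsmul := baer_nsmul hc hn
  let X : AddMonoid.End H :=
    { toFun := f
      map_zero' := map_one f
      map_add' := fun u v => by
        rw [hadd, hadd, map_mul, map_mul, map_pow]
        exact congrArg (fun z => f u * f v * z ^ n) (map_comm f u v) }
  have hX : ∀ u, X u = f u := fun _ => rfl
  have hXpow : ∀ (i : ℕ) (u : H), (X ^ i) u = (f ^ i) u := by
    intro i
    induction i with
    | zero => intro u; rfl
    | succ i ih =>
      intro u
      rw [pow_succ, pow_succ, AddMonoid.End.coe_mul, Function.comp_apply, ih]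
      rfl
  set T := X - 1 with hT
  have hTu : ∀ u, T u = f u - u := fun _ => rfl
  -- The multiples by p = 2n + 1 are the `p`-th powers, which `f` fixes.
  have hpT : ((2 * n + 1 : ℕ) : AddMonoid.End H) * T = 0 := by
    ext u
    rw [← nsmul_eq_mul]
    change (2 * n + 1) • T u = 0
    rw [hTu, smul_sub, hsmul, hsmul, ← map_pow, hfp, sub_self]
  have hTm : T ^ (2 * n + 1) ^ k = 0 := by
    refine add_one_pow_prime_pow_eq_one_imp hp hpT ?_
    rw [hT, sub_add_cancel]
    ext u
    rw [hXpow, hf]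
    rfl
  -- The Baer correction z is a power of a commutator, hence central, fixed by `f` and killed by
  -- `T`. The commutator in question equals [c_j⁻¹, c_{j+1}], so it vanishes once c_{j+1} is
  -- central.
  have hstep : ∀ j, ∃ z ∈ Subgroup.center H, f z = z ∧ c (j + 1) = T (c j) + z ∧
      (c (j + 1) ∈ Subgroup.center H → z = 1) := by
    intro j
    refine ⟨(comm (c j)⁻¹ (f (c j)) ^ n)⁻¹, inv_mem (hcn _ _), ?_, ?_, ?_⟩
    · rw [map_inv, map_pow, hfc]
    · rw [hadd' _ _ (inv_mem (hcn _ _)), hTu, sub_eq_neg_add, hadd, hsucc]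
      exact (mul_inv_cancel_right _ _).symm
    · intro h
      have h1 : f (c j) = c j * c (j + 1) := by rw [hsucc, mul_inv_cancel_left]
      rw [h1, comm_mul_right_of_mem_center (hc _ _), ← comm_inv (c (j + 1)),
        comm_eq_one_of_mem_center h]
      simp [comm]
  have hind : ∀ j, ∃ w, T w = 0 ∧ c j = (T ^ j) (c 0) + w := by
    intro j
    induction j with
    | zero => exact ⟨0, map_zero T, by simp⟩
    | succ j ih =>
      obtain ⟨w, hw, hj⟩ := ih
      obtain ⟨z, -, hz, hz', -⟩ := hstep j
      refine ⟨z, by rw [hTu, hz, sub_self], ?_⟩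
      rw [hz', hj, map_add, hw, add_zero, pow_succ', AddMonoid.End.coe_mul, Function.comp_apply]
  -- As T^{p^k} = 0, only the last correction survives: c_{p^k} equals a central z, and centrality
  -- in turn forces z = 1.
  obtain ⟨m, hm⟩ := Nat.exists_eq_succ_of_ne_zero (pow_pos hp.pos k).ne'
  rw [Nat.succ_eq_add_one] at hm
  obtain ⟨w, hw, hj⟩ := hind m
  obtain ⟨z, hz, -, hz', hz1⟩ := hstep m
  have h0 : (0 : H) = 1 := rfl
  rw [hj, map_add, hw, add_zero, ← Function.comp_apply (f := T), ← AddMonoid.End.coe_mul,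
    ← pow_succ', ← hm, hTm] at hz'
  have hcz : c ((2 * n + 1) ^ k) = z := by
    rw [hz']; exact zero_add z
  rw [hcz]
  apply hz1
  rwa [← hm, hcz]

end Baer

lemma engel_mem {G : Type*} [Group G] {x y : G} {H : Subgroup G} (hH : H.Normal) (hy : y ∈ H)
    (j : ℕ) : engel y x j ∈ H := by
  induction j with
  | zero => exact hy
  | succ j ih =>
    rw [engel_succ, comm_eq_inv_mul_conj]
    refine mul_mem (inv_mem ih) ?_
    simpa [conj] using hH.conj_mem _ ih x⁻¹

/-! ### Engel commutators in a central cover. -/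

namespace IsCentralCover

variable {p k : ℕ} {G : Type*} [Group G] {x y : G} (h : IsCentralCover p k x y)
include h

/-- On the base, `p`-th powers are multiplicative and central, so the `p`-th power of c⁻¹ c^x is
trivial. The index starts at 1 because y^p may survive. -/
lemma engel_pow_eq_one (hodd : Odd p) (j : ℕ) : engel y x (j + 1) ^ p = 1 := by
  obtain ⟨H, hH, hy, hZ, hcomm, hpow⟩ := h.exists_base hodd
  have hcen := h.relatorSubgroup_le_center
  have hcomm' : ∀ a b : H, ((comm a b : H) : G) ∈ relatorSubgroup p k x y := fun a b => by
    rw [← Subgroup.coe_subtype, map_comm]; exact hcomm a a.2 b b.2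
  have hmem := engel_mem (x := x) hH hy j
  set c := engel y x j with hc
  have hmem' : conj c x ∈ H := by simpa [conj] using hH.conj_mem _ hmem x⁻¹
  have hcp : conj c x ^ p = c ^ p := by
    have : conj c x ^ p = conj (c ^ p) x := by
      simpa [conj] using conj_pow (a := x⁻¹) (b := c) (i := p)
    rw [this, conj_eq_self_of_mem_center (hcen (hpow c hmem))]
  have key := mul_pow_of_comm_mem_center (H := H) hodd
    (fun a b => Subgroup.mem_center_iff.2 fun g => Subtype.ext
      (Subgroup.mem_center_iff.1 (hcen (hcomm' a b)) g))
    (fun a b => Subtype.ext (h.pow_eq_one_of_mem (hcomm' a b)))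
    (a := ⟨c⁻¹, inv_mem hmem⟩) (b := ⟨conj c x, hmem'⟩)
    (Subgroup.mem_center_iff.2 fun g => Subtype.ext
      (Subgroup.mem_center_iff.1 (hcen (hpow _ hmem')) g))
  have key' := congrArg Subtype.val key
  change (c⁻¹ * conj c x) ^ p = c⁻¹ ^ p * conj c x ^ p at key'
  rw [engel_succ, ← hc, comm_eq_inv_mul_conj, key', hcp, inv_pow, inv_mul_cancel]

/-- Since x^{p^k} is central, conjugation by `x` has order dividing p^k on the base and fixes its
central commutators and `p`-th powers, so `eq_one_of_pow_eq_one` applies. -/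
lemma engel_eq_one (hp : p.Prime) (hodd : Odd p) : engel y x (p ^ k) = 1 := by
  obtain ⟨H, hH, hy, hZ, hcomm, hpow⟩ := h.exists_base hodd
  let f : Monoid.End H := ((MulAut.conjNormal x⁻¹ : MulAut H) : H →* H)
  have hf : ∀ (i : ℕ) (a : H), ((f ^ i) a : G) = conj (a : G) (x ^ i) := by
    intro i
    induction i with
    | zero => intro a; simp [conj]
    | succ i ih =>
      intro a
      rw [pow_succ, Monoid.End.coe_mul, Function.comp_apply, ih]
      rw [pow_succ', ← conj_conj]
      congr 1
      change ((MulAut.conjNormal x⁻¹ a : H) : G) = _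
      simp [conj]
  have hf1 : ∀ a : H, (f a : G) = conj (a : G) x := fun a => by simpa using hf 1 a
  have hcen := h.relatorSubgroup_le_center
  have hcomm' : ∀ a b : H, ((comm a b : H) : G) ∈ relatorSubgroup p k x y := fun a b => by
    rw [← Subgroup.coe_subtype, map_comm]; exact hcomm a a.2 b b.2
  have key := eq_one_of_pow_eq_one (H := H) (k := k) hp hodd
    (fun a b => Subgroup.mem_center_iff.2 fun g => Subtype.ext
      (Subgroup.mem_center_iff.1 (hcen (hcomm' a b)) g))
    (fun a b => Subtype.ext (h.pow_eq_one_of_mem (hcomm' a b))) f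
    (by
      ext a
      rw [hf, conj, mul_assoc,
        Subgroup.mem_center_iff.1 (h.mem_center _ (Or.inl (Or.inl rfl))) (a : G),
        inv_mul_cancel_left]
      rfl)
    (fun a b => Subtype.ext (by rw [hf1, conj_eq_self_of_mem_center (hcen (hcomm' a b))]))
    (fun a => Subtype.ext (by
      rw [hf1, Subgroup.coe_pow, conj_eq_self_of_mem_center (hcen (hpow a a.2))]))
    (fun j => ⟨engel y x j, engel_mem hH hy j⟩)
    (fun j => Subtype.ext (by
      rw [Subgroup.coe_mul, Subgroup.coe_inv, hf1]
      exact (engel_succ y x j).trans (comm_eq_inv_mul_conj _ _)))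
  exact congrArg Subtype.val key

end IsCentralCover

/-! ### Factors A/B as products of cyclic groups. -/

section Factors

variable {G : Type*} [Group G]

lemma closure_image_mk_eq_top {A B : Subgroup G} [B.Normal] {S : Set G} (hS : S ⊆ A)
    (hA : A = Subgroup.closure S ⊔ B) :
    Subgroup.closure ((fun a : A => (a : A ⧸ B.subgroupOf A)) '' (Subtype.val ⁻¹' S)) = ⊤ := by
  set K := Subgroup.closure ((fun a : A => (a : A ⧸ B.subgroupOf A)) '' (Subtype.val ⁻¹' S))
  let q := QuotientGroup.mk' (B.subgroupOf A)
  have hBA : B ≤ A := hA ▸ le_sup_right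
  have hle : A ≤ (K.comap q).map A.subtype := by
    conv_lhs => rw [hA]
    refine sup_le ((Subgroup.closure_le _).2 fun s hs => ?_) fun b hb => ?_
    · exact ⟨⟨s, hS hs⟩, Subgroup.subset_closure ⟨⟨s, hS hs⟩, hs, rfl⟩, rfl⟩
    · refine ⟨⟨b, hBA hb⟩, ?_, rfl⟩
      have : q ⟨b, hBA hb⟩ = 1 := (QuotientGroup.eq_one_iff _).2 hb
      rw [SetLike.mem_coe, Subgroup.mem_comap, this]
      exact one_mem _
  rw [eq_top_iff]
  intro g _
  obtain ⟨⟨g, hg⟩, rfl⟩ := QuotientGroup.mk_surjective g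
  obtain ⟨g', hg', rfl⟩ := hle hg
  exact hg'

lemma nonempty_quotient_mulEquiv_cyc {A B : Subgroup G} [B.Normal] {a : G} {r : ℕ}
    (hA : A = Subgroup.closure {a} ⊔ B) (ha : a ^ r = 1)
    (hind : ∀ i : ℤ, a ^ i ∈ B → (r : ℤ) ∣ i) :
    Nonempty (A ⧸ B.subgroupOf A ≃* Cyc r) := by
  have haA : a ∈ A := hA ▸ (le_sup_left : _ ≤ _ ⊔ B) (Subgroup.subset_closure rfl)
  have hgen := closure_image_mk_eq_top (Set.singleton_subset_iff.2 haA) hA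
  have hpre : Subtype.val ⁻¹' {a} = ({⟨a, haA⟩} : Set A) := by ext; simp [Subtype.ext_iff]
  rw [hpre, Set.image_singleton] at hgen
  refine nonempty_mulEquiv_cyc hgen ?_ fun i hi => hind i ?_
  · rw [← QuotientGroup.mk_pow]
    exact (QuotientGroup.eq_one_iff _).2 (by
      rw [Subgroup.mem_subgroupOf, Subgroup.coe_pow]; exact ha ▸ one_mem B)
  · rw [← QuotientGroup.mk_zpow, QuotientGroup.eq_one_iff, Subgroup.mem_subgroupOf,
      Subgroup.coe_zpow] at hi
    exact hi

lemma nonempty_quotient_mulEquiv_cyc_prod {A B : Subgroup G} [B.Normal] {a b : G} {r s : ℕ}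
    (hA : A = Subgroup.closure {a, b} ⊔ B) (hab : a * b = b * a) (ha : a ^ r = 1) (hb : b ^ s = 1)
    (hind : ∀ i j : ℤ, a ^ i * b ^ j ∈ B → (r : ℤ) ∣ i ∧ (s : ℤ) ∣ j) :
    Nonempty (A ⧸ B.subgroupOf A ≃* Cyc r × Cyc s) := by
  have hsub : ({a, b} : Set G) ⊆ A := hA ▸ Subgroup.subset_closure.trans
    (SetLike.coe_subset_coe.2 (le_sup_left : _ ≤ _ ⊔ B))
  have haA : a ∈ A := hsub (Or.inl rfl)
  have hbA : b ∈ A := hsub (Or.inr rfl)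
  have hgen := closure_image_mk_eq_top hsub hA
  have hpre : Subtype.val ⁻¹' {a, b} = ({⟨a, haA⟩, ⟨b, hbA⟩} : Set A) := by
    ext; simp [Subtype.ext_iff]
  rw [hpre, Set.image_pair] at hgen
  refine nonempty_mulEquiv_cyc_prod ?_ hgen ?_ ?_ fun i j hi => hind i j ?_
  · rw [← QuotientGroup.mk_mul, ← QuotientGroup.mk_mul]
    exact congrArg _ (Subtype.ext hab)
  · rw [← QuotientGroup.mk_pow]
    exact (QuotientGroup.eq_one_iff _).2 (by
      rw [Subgroup.mem_subgroupOf, Subgroup.coe_pow]; exact ha ▸ one_mem B)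
  · rw [← QuotientGroup.mk_pow]
    exact (QuotientGroup.eq_one_iff _).2 (by
      rw [Subgroup.mem_subgroupOf, Subgroup.coe_pow]; exact hb ▸ one_mem B)
  · rw [← QuotientGroup.mk_zpow, ← QuotientGroup.mk_zpow, ← QuotientGroup.mk_mul,
      QuotientGroup.eq_one_iff, Subgroup.mem_subgroupOf, Subgroup.coe_mul, Subgroup.coe_zpow,
      Subgroup.coe_zpow] at hi
    exact hi

end Factors

/-! ### Generators of the lower central series of a central cover. -/

namespace IsCentralCover

variable {p k : ℕ} {G : Type*} [Group G] {x y : G} (h : IsCentralCover p k x y)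
include h

lemma comm_engel_mem_relatorSubgroup (hodd : Odd p) (a b : ℕ) :
    comm (engel y x a) (engel y x b) ∈ relatorSubgroup p k x y := by
  obtain ⟨H, hH, hy, -, hcomm, -⟩ := h.exists_base hodd
  exact hcomm _ (engel_mem hH hy a) _ (engel_mem hH hy b)

lemma comm_engel_mem_center (hodd : Odd p) (a b : ℕ) :
    comm (engel y x a) (engel y x b) ∈ Subgroup.center G :=
  h.relatorSubgroup_le_center (h.comm_engel_mem_relatorSubgroup hodd a b)

lemma engel_eq_one_of_le (hp : p.Prime) (hodd : Odd p) {j : ℕ} (hj : p ^ k ≤ j) :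
    engel y x j = 1 := by
  obtain ⟨i, rfl⟩ := Nat.exists_eq_add_of_le hj
  induction i with
  | zero => exact h.engel_eq_one hp hodd
  | succ i ih =>
    rw [← add_assoc, engel_succ, ih (Nat.le_add_right _ _)]
    simp [comm]

/-- The invariance under `x` of the commutator form on the base group. -/
lemma comm_engel_relation (hodd : Odd p) (a b : ℕ) :
    comm (engel y x a) (engel y x (b + 1)) * comm (engel y x (a + 1)) (engel y x b) *
      comm (engel y x (a + 1)) (engel y x (b + 1)) = 1 := by
  have hc := h.comm_engel_mem_center hodd
  have hconj : ∀ j, conj (engel y x j) x = engel y x j * engel y x (j + 1) := fun j => by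
    rw [engel_succ, comm_eq_inv_mul_conj, mul_inv_cancel_left]
  have h1 : ∀ j, comm (engel y x j) (engel y x b * engel y x (b + 1)) ∈ Subgroup.center G := by
    intro j
    rw [comm_mul_right_of_mem_center (hc _ _)]
    exact mul_mem (hc _ _) (hc _ _)
  -- Conjugation by `x` sends c_j to c_j c_{j+1} and fixes the central [c_a, c_b]; the relation is
  -- the bilinear expansion.
  have h2 := conj_comm (engel y x a) (engel y x b) x
  rw [conj_eq_self_of_mem_center (hc a b), hconj, hconj, comm_mul_left_of_mem_center (h1 _),
    comm_mul_right_of_mem_center (hc _ _), comm_mul_right_of_mem_center (hc _ _), mul_assoc,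
    left_eq_mul] at h2
  rw [mul_assoc]
  exact h2

/-- Descending induction on a + b, starting at 2p^k where one argument is trivial; inside it, the
invariance relation lowers b until b = 0, where the claim is clear. -/
lemma comm_engel_mem_lowerCentralSeries (hp : p.Prime) (hodd : Odd p) (a b : ℕ) :
    comm (engel y x a) (engel y x b) ∈ (⊤ : Subgroup G).lowerCentralSeries (a + b + 1) := by
  have key : ∀ r a b : ℕ, 2 * p ^ k ≤ a + b + r →
      comm (engel y x a) (engel y x b) ∈ (⊤ : Subgroup G).lowerCentralSeries (a + b + 1) := by
    intro r
    induction r with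
    | zero =>
      intro a b hab
      have : comm (engel y x a) (engel y x b) = 1 := by
        rcases le_or_gt (p ^ k) a with ha | ha
        · rw [h.engel_eq_one_of_le hp hodd ha]; simp [comm]
        · rw [h.engel_eq_one_of_le hp hodd (j := b) (by omega)]; simp [comm]
      rw [this]
      exact one_mem _
    | succ r ihr =>
      intro a b
      induction b generalizing a with
      | zero => exact fun _ => comm_mem_lowerCentralSeries (engel_mem_lowerCentralSeries y x a) y
      | succ b ihb =>
        intro hab
        have h1 := h.comm_engel_relation hodd a b
        rw [mul_assoc] at h1
        rw [eq_inv_of_mul_eq_one_left h1]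
        refine inv_mem (mul_mem ?_ ?_)
        · have := ihb (a + 1) (by omega)
          rwa [show a + 1 + b + 1 = a + (b + 1) + 1 by ring] at this
        · exact Subgroup.lowerCentralSeries_antitone _ (by omega)
            (ihr (a + 1) (b + 1) (by omega))
  exact key (2 * p ^ k) a b (by omega)

/-- The gain of one term over `comm_engel_mem_lowerCentralSeries`: the indices differ by an even
number, so moving entries ends at a commutator of an element with itself. -/
lemma comm_engel_two_mul_mem (hp : p.Prime) (hodd : Odd p) (j b : ℕ) :
    comm (engel y x (b + 2 * j)) (engel y x b) ∈
      (⊤ : Subgroup G).lowerCentralSeries (2 * b + 2 * j + 2) := by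
  induction j generalizing b with
  | zero => rw [mul_zero, add_zero b, comm_self]; exact one_mem _
  | succ j ih =>
    have h1 := h.comm_engel_relation hodd (b + 2 * j + 1) b
    have h2 := Subgroup.mem_center_iff.1 (h.comm_engel_mem_center hodd (b + 2 * j + 2) b)
      (comm (engel y x (b + 2 * j + 1)) (engel y x (b + 1)))
    rw [h2, mul_assoc] at h1
    rw [show b + 2 * (j + 1) = b + 2 * j + 2 by ring, eq_inv_of_mul_eq_one_left h1]
    refine inv_mem (mul_mem ?_ ?_)
    · have := ih (b + 1)
      rw [show b + 1 + 2 * j = b + 2 * j + 1 by ring] at this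
      exact Subgroup.lowerCentralSeries_antitone _ (by omega) this
    · exact Subgroup.lowerCentralSeries_antitone _ (by omega)
        (h.comm_engel_mem_lowerCentralSeries hp hodd (b + 2 * j + 2) (b + 1))

lemma lowerCentralSeries_one_eq : (⊤ : Subgroup G).lowerCentralSeries 1 =
    Subgroup.closure {engel y x 1} ⊔ (⊤ : Subgroup G).lowerCentralSeries 2 := by
  refine lowerCentralSeries_succ_eq_of_eq (S := {x, y}) h.closure_eq ?_ ?_ ?_
  · rw [h.closure_eq, top_sup_eq]; rfl
  · rintro _ rfl
    exact engel_mem_lowerCentralSeries y x 1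
  · have h1 : engel y x 1 ∈ Subgroup.closure {engel y x 1} ⊔
        (⊤ : Subgroup G).lowerCentralSeries 2 :=
      (le_sup_left : _ ≤ _ ⊔ (⊤ : Subgroup G).lowerCentralSeries 2)
        (Subgroup.subset_closure rfl)
    rintro _ (rfl | rfl) _ (rfl | rfl)
    · rw [comm_self]; exact one_mem _
    · rw [← comm_inv]; exact inv_mem h1
    · exact h1
    · rw [comm_self]; exact one_mem _

lemma lowerCentralSeries_even_of_odd (i : ℕ)
    (hi : (⊤ : Subgroup G).lowerCentralSeries (2 * i + 1) =
      Subgroup.closure {engel y x (2 * i + 1)} ⊔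
        (⊤ : Subgroup G).lowerCentralSeries (2 * i + 2)) :
    (⊤ : Subgroup G).lowerCentralSeries (2 * i + 2) =
      Subgroup.closure {engel y x (2 * i + 2), comm (engel y x (2 * i + 1)) y} ⊔
        (⊤ : Subgroup G).lowerCentralSeries (2 * i + 3) := by
  refine lowerCentralSeries_succ_eq_of_eq h.closure_eq hi ?_ ?_
  · rintro _ (rfl | rfl)
    · exact engel_mem_lowerCentralSeries y x _
    · exact comm_mem_lowerCentralSeries (engel_mem_lowerCentralSeries y x _) y
  · rintro _ rfl _ (rfl | rfl)
    · exact Subgroup.mem_sup_left (Subgroup.subset_closure (Or.inl (engel_succ _ _ _).symm))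
    · exact Subgroup.mem_sup_left (Subgroup.subset_closure (Or.inr rfl))

/-- Of the possible new generators, those from the central [c_{2i+1}, y] vanish and [c_{2i+2}, y]
lies one term deeper, leaving c_{2i+3}. -/
lemma lowerCentralSeries_odd (hp : p.Prime) (hodd : Odd p) (i : ℕ) :
    (⊤ : Subgroup G).lowerCentralSeries (2 * i + 1) =
      Subgroup.closure {engel y x (2 * i + 1)} ⊔
        (⊤ : Subgroup G).lowerCentralSeries (2 * i + 2) := by
  induction i with
  | zero => exact h.lowerCentralSeries_one_eq
  | succ i ih =>
    refine lowerCentralSeries_succ_eq_of_eq h.closure_eq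
      (h.lowerCentralSeries_even_of_odd i ih) ?_ ?_
    · rintro _ rfl
      exact engel_mem_lowerCentralSeries y x _
    · have hz : ∀ g, comm (comm (engel y x (2 * i + 1)) y) g = 1 :=
        comm_eq_one_of_mem_center (h.comm_engel_mem_center hodd (2 * i + 1) 0)
      rintro _ (rfl | rfl) _ (rfl | rfl)
      · exact Subgroup.mem_sup_left (Subgroup.subset_closure (engel_succ _ _ _).symm)
      · have := h.comm_engel_two_mul_mem hp hodd (i + 1) 0
        rw [zero_add] at this
        exact Subgroup.mem_sup_right (Subgroup.lowerCentralSeries_antitone _ (by omega) this)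
      · rw [hz]; exact one_mem _
      · rw [hz]; exact one_mem _

lemma lowerCentralSeries_even (hp : p.Prime) (hodd : Odd p) (i : ℕ) :
    (⊤ : Subgroup G).lowerCentralSeries (2 * i + 2) =
      Subgroup.closure {engel y x (2 * i + 2), comm (engel y x (2 * i + 1)) y} ⊔
        (⊤ : Subgroup G).lowerCentralSeries (2 * i + 3) :=
  h.lowerCentralSeries_even_of_odd i (h.lowerCentralSeries_odd hp hodd i)

/-- As p^k is odd, the only generator of this term modulo the next is c_{p^k} = 1. The series is
stationary from here, and nilpotency makes it trivial. -/
lemma lowerCentralSeries_eq_bot (hp : p.Prime) (hodd : Odd p) :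
    (⊤ : Subgroup G).lowerCentralSeries (p ^ k) = ⊥ := by
  have := h.isNilpotent hp hodd
  obtain ⟨j, hj⟩ := hodd.pow (n := k)
  have h1 : (⊤ : Subgroup G).lowerCentralSeries (p ^ k) =
      (⊤ : Subgroup G).lowerCentralSeries (p ^ k + 1) := by
    have h2 := h.lowerCentralSeries_odd hp hodd j
    rwa [← hj, h.engel_eq_one hp hodd, Subgroup.closure_singleton_one, bot_sup_eq,
      show 2 * j + 2 = p ^ k + 1 by omega] at h2
  have h3 : ∀ i, (⊤ : Subgroup G).lowerCentralSeries (p ^ k + i) =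
      (⊤ : Subgroup G).lowerCentralSeries (p ^ k) := by
    intro i
    induction i with
    | zero => rfl
    | succ i ih =>
      rw [← add_assoc, Subgroup.lowerCentralSeries_succ, ih, ← Subgroup.lowerCentralSeries_succ,
        ← h1]
  rw [← h3 (Group.nilpotencyClass G), eq_bot_iff, ← Subgroup.lowerCentralSeries_nilpotencyClass]
  exact Subgroup.lowerCentralSeries_antitone _ (Nat.le_add_left _ _)

lemma comm_engel_pow_eq_one (hodd : Odd p) (j : ℕ) : comm (engel y x j) y ^ p = 1 :=
  h.pow_eq_one_of_mem (h.comm_engel_mem_relatorSubgroup hodd j 0)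

end IsCentralCover

/-! ### Heisenberg groups extended by an isometry. -/

section Heisenberg

variable {K V : Type*} [CommRing K] [AddCommGroup V] [Module K V]

/-- The Heisenberg group `V × K` of a bilinear form `B` on `V`, with the multiplication
`(v, z) (v', z') = (v + v', z + z' + B(v, v'))`. -/
@[ext]
structure Heis (B : V →ₗ[K] V →ₗ[K] K) where
  /-- The component in the module. -/
  vec : V
  /-- The component in the centre. -/
  cen : K

variable {B : V →ₗ[K] V →ₗ[K] K}

namespace Heis

instance : Mul (Heis B) := ⟨fun a b => ⟨a.vec + b.vec, a.cen + b.cen + B a.vec b.vec⟩⟩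
instance : One (Heis B) := ⟨⟨0, 0⟩⟩
instance : Inv (Heis B) := ⟨fun a => ⟨-a.vec, -a.cen + B a.vec a.vec⟩⟩

@[simp] lemma mul_vec (a b : Heis B) : (a * b).vec = a.vec + b.vec := rfl
@[simp] lemma mul_cen (a b : Heis B) : (a * b).cen = a.cen + b.cen + B a.vec b.vec := rfl
@[simp] lemma one_vec : (1 : Heis B).vec = 0 := rfl
@[simp] lemma one_cen : (1 : Heis B).cen = 0 := rfl
@[simp] lemma inv_vec (a : Heis B) : a⁻¹.vec = -a.vec := rfl
@[simp] lemma inv_cen (a : Heis B) : a⁻¹.cen = -a.cen + B a.vec a.vec := rfl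

instance : Group (Heis B) := Group.ofLeftAxioms
  (fun a b c => by
    ext
    · simp [add_assoc]
    · simp; ring)
  (fun a => by ext <;> simp)
  (fun a => by ext <;> simp)

instance [Finite V] [Finite K] : Finite (Heis B) :=
  Finite.of_injective (fun a : Heis B => (a.vec, a.cen)) fun _ _ h =>
    Heis.ext (congrArg Prod.fst h) (congrArg Prod.snd h)

lemma comm_eq (a b : Heis B) : comm a b = ⟨0, B a.vec b.vec - B b.vec a.vec⟩ := by
  ext
  · simp [comm]
  · simp [comm]; ring

lemma mul_comm_of_vec_eq_zero {a : Heis B} (ha : a.vec = 0) (b : Heis B) : b * a = a * b := by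
  ext <;> simp [ha, add_comm]

lemma pow_eq (hB : ∀ v, B v v = 0) (a : Heis B) (n : ℕ) : a ^ n = ⟨n • a.vec, n • a.cen⟩ := by
  induction n with
  | zero => ext <;> simp
  | succ n ih =>
    rw [pow_succ, ih]
    ext
    · exact (succ_nsmul a.vec n).symm
    · simp [add_mul, hB]

lemma zpow_vec (a : Heis B) (n : ℤ) : (a ^ n).vec = n • a.vec := by
  let f : Heis B →* Multiplicative V :=
    { toFun := fun a => Multiplicative.ofAdd a.vec
      map_one' := rfl
      map_mul' := fun _ _ => rfl }
  exact congrArg Multiplicative.toAdd (map_zpow f a n)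

lemma zpow_cen_of_vec_eq_zero (z : K) (n : ℤ) : ((⟨0, z⟩ : Heis B) ^ n).cen = n • z := by
  let f : Multiplicative K →* Heis B :=
    { toFun := fun z => ⟨0, z.toAdd⟩
      map_one' := rfl
      map_mul' := fun a b => by ext <;> simp }
  exact congrArg Heis.cen (map_zpow f (Multiplicative.ofAdd z) n).symm

/-- The automorphism of the Heisenberg group induced by an isometry. -/
def ofIsometry (X : (Module.End K V)ˣ) (hX : ∀ u v, B (X.1 u) (X.1 v) = B u v) :
    MulAut (Heis B) where
  toFun a := ⟨X.1 a.vec, a.cen⟩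
  invFun a := ⟨X⁻¹.1 a.vec, a.cen⟩
  left_inv a := by
    ext
    · change (X⁻¹.1 * X.1) a.vec = a.vec
      simp
    · rfl
  right_inv a := by
    ext
    · change (X.1 * X⁻¹.1) a.vec = a.vec
      simp
    · rfl
  map_mul' a b := by
    ext
    · simp
    · simp [hX]

lemma ofIsometry_pow_apply (X : (Module.End K V)ˣ) (hX : ∀ u v, B (X.1 u) (X.1 v) = B u v)
    (n : ℕ) (a : Heis B) : (ofIsometry X hX ^ n) a = ⟨(X.1 ^ n) a.vec, a.cen⟩ := by
  induction n generalizing a with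
  | zero => rfl
  | succ n ih => rw [pow_succ, MulAut.mul_apply, ih, pow_succ]; rfl

end Heis

/-- The extension of the Heisenberg group by the cyclic group generated by an isometry. -/
abbrev HeisExt (f : MulAut (Heis B)) : Type _ :=
  Heis B ⋊[(Subgroup.zpowers f).subtype] (Subgroup.zpowers f)

namespace HeisExt

variable {p k : ℕ} {X : (Module.End K V)ˣ} {hX : ∀ u v, B (X.1 u) (X.1 v) = B u v}

/-- The element acting as the given isometry. -/
def gen (f : MulAut (Heis B)) : HeisExt f :=
  -- The inverse matches the convention a^b = b⁻¹ a b, so that conjugation by this element is `f`.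
  SemidirectProduct.inr ⟨f, Subgroup.mem_zpowers f⟩⁻¹

/-- An element of the Heisenberg group. -/
def emb (f : MulAut (Heis B)) : Heis B →* HeisExt f := SemidirectProduct.inl

lemma emb_injective (f : MulAut (Heis B)) : Function.Injective (emb f) :=
  SemidirectProduct.inl_injective

lemma conj_emb_gen (f : MulAut (Heis B)) (a : Heis B) : conj (emb f a) (gen f) = emb f (f a) := by
  ext <;> simp [conj, emb, gen]

lemma gen_pow_eq_one {f : MulAut (Heis B)} {n : ℕ} (hf : f ^ n = 1) : gen f ^ n = 1 := by
  rw [gen, ← map_pow, inv_pow]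
  have : (⟨f, Subgroup.mem_zpowers f⟩ : Subgroup.zpowers f) ^ n = 1 := Subtype.ext hf
  rw [this, inv_one, map_one]

lemma exists_emb_pow_eq {f : MulAut (Heis B)} {n : ℕ} (hf : f ^ n = 1) (w : HeisExt f) :
    ∃ a, w ^ n = emb f a := by
  refine ⟨(w ^ n).left, SemidirectProduct.ext rfl ?_⟩
  change SemidirectProduct.rightHom (w ^ n) = 1
  rw [map_pow]
  obtain ⟨i, hi⟩ := w.right.2
  refine Subtype.ext ?_
  change (w.right : MulAut (Heis B)) ^ n = 1
  rw [← hi, ← zpow_natCast]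
  change (f ^ i) ^ (n : ℤ) = 1
  rw [zpow_comm, zpow_natCast, hf, one_zpow]

lemma conj_emb_gen_pow (f : MulAut (Heis B)) (a : Heis B) (n : ℕ) :
    conj (emb f a) (gen f ^ n) = emb f ((f ^ n) a) := by
  induction n generalizing a with
  | zero => simp [conj]
  | succ n ih => rw [pow_succ', ← conj_conj, conj_emb_gen, ih, pow_succ]; rfl

lemma emb_mem_center (z : K) :
    emb (Heis.ofIsometry X hX) ⟨0, z⟩ ∈ Subgroup.center (HeisExt (Heis.ofIsometry X hX)) := by
  rw [Subgroup.mem_center_iff]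
  have hfix : ∀ g ∈ Subgroup.zpowers (Heis.ofIsometry X hX), g ⟨0, z⟩ = ⟨0, z⟩ := by
    have : Subgroup.zpowers (Heis.ofIsometry X hX) ≤
        MulAction.stabilizer (MulAut (Heis B)) (⟨0, z⟩ : Heis B) := by
      rw [Subgroup.zpowers_le, MulAction.mem_stabilizer_iff]
      ext
      · exact map_zero X.1
      · rfl
    exact fun g hg => this hg
  intro w
  refine SemidirectProduct.ext ?_ (by simp [emb])
  change w.left * (w.right : MulAut (Heis B)) ⟨0, z⟩ = ⟨0, z⟩ * (1 : MulAut (Heis B)) w.left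
  rw [hfix _ w.right.2, MulAut.one_apply, Heis.mul_comm_of_vec_eq_zero rfl]

/-- On vectors, commutation with `gen` is X - 1; the central coordinate never matters. -/
lemma engel_eq (u : V) (j : ℕ) : ∃ z, engel (emb (Heis.ofIsometry X hX) ⟨u, 0⟩)
    (gen (Heis.ofIsometry X hX)) j = emb _ ⟨((X.1 - 1) ^ j) u, z⟩ := by
  induction j with
  | zero => exact ⟨0, rfl⟩
  | succ j ih =>
    obtain ⟨z, hz⟩ := ih
    rw [engel_succ, hz, comm_eq_inv_mul_conj, conj_emb_gen, ← map_inv, ← map_mul]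
    refine ⟨_, congrArg _ (Heis.ext ?_ rfl)⟩
    rw [pow_succ']
    change -_ + X.1 _ = X.1 _ - _
    rw [neg_add_eq_sub]
    rfl

lemma comm_emb (hB : ∀ v, B v v = 0) (a b : Heis B) (f : MulAut (Heis B)) :
    comm (emb f a) (emb f b) = emb f ⟨0, 2 * B a.vec b.vec⟩ := by
  have h := hB (a.vec + b.vec)
  simp only [map_add, LinearMap.add_apply, hB, zero_add, add_zero] at h
  rw [← map_comm, Heis.comm_eq]
  congr 2
  linear_combination -h

end HeisExt

end Heisenberg

namespace HeisExt

variable {p k : ℕ} {V : Type*} [AddCommGroup V] [Module (ZMod p) V]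
  {B : V →ₗ[ZMod p] V →ₗ[ZMod p] ZMod p} {X : (Module.End (ZMod p) V)ˣ}
  {hX : ∀ u v, B (X.1 u) (X.1 v) = B u v}

lemma emb_pow_eq_one (hB : ∀ v, B v v = 0) (f : MulAut (Heis B)) (a : Heis B) :
    emb f a ^ p = 1 := by
  have hV : p • a.vec = 0 := by rw [← Nat.cast_smul_eq_nsmul (ZMod p), CharP.cast_eq_zero, zero_smul]
  have hK : p • a.cen = 0 := by rw [nsmul_eq_mul, CharP.cast_eq_zero, zero_mul]
  rw [← map_pow, Heis.pow_eq hB, hV, hK]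
  exact map_one _

lemma ofIsometry_pow_eq_one (h : X.1 ^ p ^ k = 1) : Heis.ofIsometry X hX ^ p ^ k = 1 := by
  ext a
  · rw [Heis.ofIsometry_pow_apply, h]; rfl
  · rw [Heis.ofIsometry_pow_apply]; rfl

lemma isPGroup (hB : ∀ v, B v v = 0) {f : MulAut (Heis B)} (hf : f ^ p ^ k = 1) :
    IsPGroup p (HeisExt f) := by
  intro w
  obtain ⟨a, ha⟩ := exists_emb_pow_eq hf w
  exact ⟨k + 1, by rw [pow_succ, pow_mul, ha, emb_pow_eq_one hB]⟩

lemma relators_central (hB : ∀ v, B v v = 0) (h : X.1 ^ p ^ k = 1) (a : Heis B) :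
    ∀ r ∈ relators p k (gen (Heis.ofIsometry X hX)) (emb (Heis.ofIsometry X hX) a),
      r ∈ Subgroup.center _ ∧ r ^ p = 1 := by
  have hf := ofIsometry_pow_eq_one (hX := hX) h
  rintro _ ((rfl | rfl) | ⟨i, -, -, rfl⟩)
  · rw [gen_pow_eq_one hf, one_pow]
    exact ⟨one_mem _, rfl⟩
  · rw [emb_pow_eq_one hB, one_pow]
    exact ⟨one_mem _, rfl⟩
  · rw [conj_emb_gen_pow, comm_emb hB]
    exact ⟨emb_mem_center _, emb_pow_eq_one hB _ _⟩

lemma finite [NeZero p] [Finite V] (f : MulAut (Heis B)) : Finite (HeisExt f) := by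
  have : Finite (MulAut (Heis B)) := Finite.of_injective (fun g => (g : Heis B → Heis B))
    DFunLike.coe_injective
  exact Finite.of_equiv _ SemidirectProduct.equivProd.symm

end HeisExt

/-! ### The shift, the alternating form, the Cayley transform and the test groups. -/

section Shift

variable {K : Type*} [CommRing K] (n : ℕ)

/-- The nilpotent shift on `K ^ (n + 1)`. -/
def shift : Module.End K (Fin (n + 1) → K) where
  toFun v := Fin.cons 0 fun a : Fin n => v a.castSucc
  map_add' u v := by
    ext a
    refine Fin.cases ?_ (fun a => ?_) a <;> simp
  map_smul' c v := by
    ext a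
    refine Fin.cases ?_ (fun a => ?_) a <;> simp

lemma shift_apply_zero (v : Fin (n + 1) → K) : shift n v 0 = 0 := rfl

lemma shift_apply_succ (v : Fin (n + 1) → K) (a : Fin n) : shift n v a.succ = v a.castSucc := rfl

lemma shift_pow_apply_of_lt (v : Fin (n + 1) → K) (j : ℕ) (a : Fin (n + 1)) (ha : (a : ℕ) < j) :
    (shift n ^ j) v a = 0 := by
  induction j generalizing a with
  | zero => omega
  | succ j ih =>
    rw [pow_succ', Module.End.mul_apply]
    induction a using Fin.cases with
    | zero => rfl
    | succ a => exact ih a.castSucc (by simpa using ha)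

lemma shift_pow_apply_self (v : Fin (n + 1) → K) (j : ℕ) (a : Fin (n + 1)) (ha : (a : ℕ) = j) :
    (shift n ^ j) v a = v 0 := by
  induction j generalizing a with
  | zero => rw [Fin.ext (b := 0) ha]; rfl
  | succ j ih =>
    rw [pow_succ', Module.End.mul_apply]
    induction a using Fin.cases with
    | zero => simp at ha
    | succ a => exact ih a.castSucc (by simpa using ha)

lemma shift_pow_succ_eq_zero : (shift n : Module.End K (Fin (n + 1) → K)) ^ (n + 1) = 0 := by
  refine LinearMap.ext fun v => funext fun a => ?_
  exact shift_pow_apply_of_lt n v _ a a.2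

/-- The form `B(u, v) = ∑ (-1) ^ a u_a v_{n - a}` on `K ^ (n + 1)`. -/
def signForm : (Fin (n + 1) → K) →ₗ[K] (Fin (n + 1) → K) →ₗ[K] K :=
  LinearMap.mk₂ K (fun u v => ∑ a : Fin (n + 1), (-1) ^ (a : ℕ) * u a * v a.rev)
    (fun u u' v => by simp [mul_add, add_mul, Finset.sum_add_distrib])
    (fun c u v => by
      rw [smul_eq_mul, Finset.mul_sum]
      exact Finset.sum_congr rfl fun a _ => by rw [Pi.smul_apply, smul_eq_mul]; ring)
    (fun u v v' => by simp [mul_add, Finset.sum_add_distrib])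
    (fun c u v => by
      rw [smul_eq_mul, Finset.mul_sum]
      exact Finset.sum_congr rfl fun a _ => by rw [Pi.smul_apply, smul_eq_mul]; ring)

lemma signForm_apply (u v : Fin (n + 1) → K) :
    signForm n u v = ∑ a : Fin (n + 1), (-1) ^ (a : ℕ) * u a * v a.rev := rfl

/-- The shift is an infinitesimal isometry, to be turned into an isometry by the Cayley transform.
-/
lemma signForm_shift (u v : Fin (n + 1) → K) :
    signForm n (shift n u) v = - signForm n u (shift n v) := by
  rw [signForm_apply, signForm_apply, Fin.sum_univ_succ, Fin.sum_univ_castSucc,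
    ← sub_eq_zero]
  simp [shift_apply_zero, shift_apply_succ, Fin.rev_succ, Fin.rev_castSucc, pow_succ]

lemma signForm_swap (hn : Odd n) (u v : Fin (n + 1) → K) :
    signForm n u v = - signForm n v u := by
  rw [signForm_apply, signForm_apply, ← Equiv.sum_comp Fin.revPerm, ← Finset.sum_neg_distrib]
  refine Finset.sum_congr rfl fun a _ => ?_
  have h1 : (-1 : K) ^ (a.rev : ℕ) = -(-1) ^ (a : ℕ) := by
    have h2 : (-1 : K) ^ (a.rev : ℕ) * (-1) ^ (a : ℕ) = -1 := by
      rw [← pow_add, Fin.val_rev, show n + 1 - (a + 1) + a = n by omega, hn.neg_one_pow]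
    have h3 : (-1 : K) ^ (a : ℕ) * (-1) ^ (a : ℕ) = 1 := by
      rw [← mul_pow]; simp
    calc (-1 : K) ^ (a.rev : ℕ) = (-1 : K) ^ (a.rev : ℕ) * ((-1) ^ (a : ℕ) * (-1) ^ (a : ℕ)) := by
          rw [h3, mul_one]
      _ = _ := by rw [← mul_assoc, h2]; ring
  rw [Fin.revPerm_apply, Fin.rev_rev, h1]
  ring

lemma signForm_shift_pow_self :
    signForm n ((shift n ^ n) (Pi.single 0 1)) (Pi.single 0 1 : Fin (n + 1) → K) = (-1) ^ n := by
  rw [signForm_apply, Fin.sum_univ_castSucc, Finset.sum_eq_zero, zero_add, Fin.rev_last,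
    shift_pow_apply_self n _ n _ (Fin.val_last n)]
  · simp
  · intro a _
    rw [Fin.rev_castSucc, Pi.single_eq_of_ne (Fin.succ_ne_zero _), mul_zero]

end Shift

/-- The Cayley transform of a nilpotent element: if `2` is invertible, there is a unit `X` with
`(1 + N / 2) = X (1 - N / 2)`, and the highest non-zero power of `X - 1` is that of `N`. -/
lemma exists_cayley {K S : Type*} [Field K] [Ring S] [Algebra K S] (h2 : (2 : K) ≠ 0) {N : S} {n : ℕ}
    (hN : N ^ (n + 1) = 0) : ∃ X : Sˣ, (1 + (2⁻¹ : K) • N) = X.1 * (1 - (2⁻¹ : K) • N) ∧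
      (X.1 - 1) ^ (n + 1) = 0 ∧ (X.1 - 1) ^ n = N ^ n := by
  set M := (2⁻¹ : K) • N with hM
  have hNM : N = M + M := by
    rw [hM, ← add_smul, ← two_mul, mul_inv_cancel₀ h2, one_smul]
  have hMN : Commute M N := (Commute.refl N).smul_left _
  have hMnil : IsNilpotent M := ⟨n + 1, by rw [hM, smul_pow, hN, smul_zero]⟩
  obtain ⟨P, hP⟩ := hMnil.isUnit_one_add
  obtain ⟨Q, hQ⟩ := hMnil.isUnit_one_sub
  have hQN : Commute (Q⁻¹.1) N := by
    have : Commute (Q : S) N := by rw [hQ]; exact (Commute.one_left N).sub_left hMN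
    exact this.units_inv_left
  -- With P - Q = N, the difference X - 1 is N Q⁻¹; as Q is 1 modulo N, the top power N^n absorbs
  -- Q⁻¹.
  have hT : (P * Q⁻¹).1 - 1 = N * Q⁻¹.1 := by
    have : N = P - Q := by rw [hP, hQ, hNM]; abel
    rw [this, sub_mul, Units.mul_inv, Units.val_mul]
  have hNQ : N ^ n * Q⁻¹.1 = N ^ n := by
    have h1 : N ^ n * Q = N ^ n := by
      rw [hQ, mul_sub, mul_one, hM, mul_smul_comm, ← pow_succ, hN, smul_zero, sub_zero]
    conv_lhs => rw [← h1]
    rw [mul_assoc, Units.mul_inv, mul_one]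
  refine ⟨P * Q⁻¹, ?_, ?_, ?_⟩
  · rw [← hP, ← hQ, Units.val_mul, mul_assoc, Units.inv_mul, mul_one]
  · rw [hT, hQN.symm.mul_pow, hN, zero_mul]
  · rw [hT, hQN.symm.mul_pow]
    have : ∀ j : ℕ, N ^ n * Q⁻¹.1 ^ j = N ^ n := by
      intro j
      induction j with
      | zero => rw [pow_zero, mul_one]
      | succ j ih => rw [pow_succ, ← mul_assoc, ih, hNQ]
    exact this n

/-- The Cayley transform of an infinitesimal isometry is an isometry. -/
lemma cayley_isometry {K V : Type*} [Field K] [AddCommGroup V] [Module K V]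
    {B : V →ₗ[K] V →ₗ[K] K} {N : Module.End K V} (hBN : ∀ u v, B (N u) v = - B u (N v))
    {X : (Module.End K V)ˣ} {c : K} (hX : 1 + c • N = X.1 * (1 - c • N))
    (hnil : IsNilpotent N) (u v : V) : B (X.1 u) (X.1 v) = B u v := by
  have hunit : IsUnit (1 - c • N) := (hnil.smul c).isUnit_one_sub
  obtain ⟨Q, hQ⟩ := hunit
  -- Writing both arguments as values of 1 - cN reduces the claim to comparing 1 + cN with 1 - cN,
  -- where skewness cancels the terms linear in c.
  have hsurj : ∀ u, ∃ u', (1 - c • N) u' = u := fun u => ⟨Q⁻¹.1 u, by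
    rw [← hQ, ← Module.End.mul_apply, Units.mul_inv, Module.End.one_apply]⟩
  obtain ⟨u, rfl⟩ := hsurj u
  obtain ⟨v, rfl⟩ := hsurj v
  rw [← Module.End.mul_apply, ← Module.End.mul_apply, ← hX]
  simp only [LinearMap.add_apply, LinearMap.sub_apply, LinearMap.smul_apply, Module.End.one_apply,
    map_add, map_sub, map_smul, smul_eq_mul, hBN]
  ring

lemma unipotent_pow_eq_one {p k d : ℕ} [Fact p.Prime] {S : Type*} [Ring S] [Algebra (ZMod p) S]
    {X : S} (hX : (X - 1) ^ d = 0) (hd : d ≤ p ^ k) : X ^ p ^ k = 1 := by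
  have hp : (p : S) = 0 := by
    rw [← map_natCast (algebraMap (ZMod p) S), CharP.cast_eq_zero, map_zero]
  obtain ⟨r, hr⟩ := (Commute.one_right (X - 1)).exists_add_pow_prime_pow_eq
    (Fact.out : p.Prime) k
  rw [hp, zero_mul, zero_mul, zero_mul, add_zero, sub_add_cancel, one_pow,
    pow_eq_zero_of_le hd hX, zero_add] at hr
  exact hr

lemma zmod_two_ne_zero {p : ℕ} (hp : p.Prime) (hodd : Odd p) : (2 : ZMod p) ≠ 0 := by
  intro h
  rw [show (2 : ZMod p) = ((2 : ℕ) : ZMod p) by norm_cast, ZMod.natCast_eq_zero_iff,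
    Nat.prime_dvd_prime_iff_eq hp Nat.prime_two] at h
  subst h
  exact absurd hodd (by decide)

/-- A finite `p`-group that satisfies the relations of the wreath product up to central elements
of order `p`, and detects `[y, x, …, x]` with `d` entries `x` modulo the later ones. -/
lemma exists_group_detecting_engel {p k d : ℕ} (hp : p.Prime) (hodd : Odd p) (hd : d + 1 ≤ p ^ k) :
    ∃ (P : Type) (_ : Group P) (_ : Finite P) (a b : P) (C : Subgroup P), IsPGroup p P ∧
      (∀ r ∈ relators p k a b, r ∈ Subgroup.center P ∧ r ^ p = 1) ∧
      (∀ j, d < j → engel b a j ∈ C) ∧ (∀ j, comm (engel b a j) b ∈ C) ∧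
      ∀ i : ℤ, engel b a d ^ i ∈ C → (p : ℤ) ∣ i := by
  have := Fact.mk hp
  have h2 := zmod_two_ne_zero hp hodd
  obtain ⟨X, -, hX0, hX1⟩ := exists_cayley h2 (shift_pow_succ_eq_zero (K := ZMod p) d)
  -- Only the vector of c_d has to be seen, so the zero form suffices and any `X` is an isometry.
  let B : (Fin (d + 1) → ZMod p) →ₗ[ZMod p] (Fin (d + 1) → ZMod p) →ₗ[ZMod p] ZMod p := 0
  have hX : ∀ u v, B (X.1 u) (X.1 v) = B u v := fun _ _ => rfl
  have hB : ∀ v, B v v = 0 := fun _ => rfl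
  have hpow := unipotent_pow_eq_one hX0 hd
  let f := Heis.ofIsometry X hX
  let C : Subgroup (HeisExt f) := Subgroup.map (HeisExt.emb f)
    { carrier := {a | a.vec = 0}
      mul_mem' := fun {a b} ha hb => by
        change a.vec + b.vec = 0
        rw [show a.vec = 0 from ha, show b.vec = 0 from hb, add_zero]
      one_mem' := rfl
      inv_mem' := fun {a} ha => by
        change -a.vec = 0
        rw [show a.vec = 0 from ha, neg_zero] }
  have hC : ∀ a : Heis B, HeisExt.emb f a ∈ C ↔ a.vec = 0 := fun a =>
    (Subgroup.mem_map_iff_mem (HeisExt.emb_injective f))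
  refine ⟨HeisExt f, inferInstance, HeisExt.finite f, HeisExt.gen f,
    HeisExt.emb f ⟨Pi.single 0 1, 0⟩, C, HeisExt.isPGroup hB (HeisExt.ofIsometry_pow_eq_one hpow),
    HeisExt.relators_central hB hpow _, ?_, ?_, ?_⟩
  · intro j hj
    obtain ⟨z, hz⟩ := HeisExt.engel_eq (hX := hX) (Pi.single 0 1) j
    rw [hz, hC, pow_eq_zero_of_le hj hX0]
    rfl
  · intro j
    obtain ⟨z, hz⟩ := HeisExt.engel_eq (hX := hX) (Pi.single 0 1) j
    rw [hz, HeisExt.comm_emb hB, hC]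
  · intro i
    obtain ⟨z, hz⟩ := HeisExt.engel_eq (hX := hX) (Pi.single 0 1) d
    rw [hz, ← map_zpow, hC, Heis.zpow_vec, hX1]
    intro h
    have h1 : (i • (shift d ^ d) (Pi.single 0 1)) (Fin.last d) = (0 : ZMod p) :=
      congrFun h (Fin.last d)
    rw [Pi.smul_apply, shift_pow_apply_self d _ d _ (Fin.val_last d), Pi.single_eq_same,
      zsmul_one] at h1
    exact (ZMod.intCast_zmod_eq_zero_iff_dvd _ _).1 h1

/-- A finite `p`-group that satisfies the relations of the wreath product up to central elements
of order `p`, and detects `[y, x, …, x, y]` with `n` entries `x`, for odd `n`. -/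
lemma exists_group_detecting_comm {p k n : ℕ} (hp : p.Prime) (hodd : Odd p) (hn : Odd n)
    (hd : n + 1 ≤ p ^ k) :
    ∃ (P : Type) (_ : Group P) (_ : Finite P) (a b : P), IsPGroup p P ∧
      (∀ r ∈ relators p k a b, r ∈ Subgroup.center P ∧ r ^ p = 1) ∧
      (∀ j, n + 1 < j → engel b a j = 1) ∧ (∀ j, n < j → comm (engel b a j) b = 1) ∧
      ∀ i : ℤ, comm (engel b a n) b ^ i = 1 → (p : ℤ) ∣ i := by
  have := Fact.mk hp
  have h2 := zmod_two_ne_zero hp hodd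
  have hN := shift_pow_succ_eq_zero (K := ZMod p) n
  obtain ⟨X, hXc, hX0, hX1⟩ := exists_cayley h2 hN
  let B : (Fin (n + 1) → ZMod p) →ₗ[ZMod p] (Fin (n + 1) → ZMod p) →ₗ[ZMod p] ZMod p := signForm n
  have hX : ∀ u v, B (X.1 u) (X.1 v) = B u v := cayley_isometry (signForm_shift n) hXc ⟨_, hN⟩
  have hB : ∀ v, B v v = 0 := fun v => by
    have h := signForm_swap n hn v v
    rw [eq_neg_iff_add_eq_zero, ← two_mul] at h
    exact (mul_eq_zero.1 h).resolve_left h2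
  have hpow := unipotent_pow_eq_one hX0 hd
  let f := Heis.ofIsometry X hX
  have hz : ∀ j, n < j → ∃ z, engel (HeisExt.emb f ⟨Pi.single 0 1, 0⟩) (HeisExt.gen f) j =
      HeisExt.emb f ⟨0, z⟩ := by
    intro j hj
    obtain ⟨z, hz⟩ := HeisExt.engel_eq (hX := hX) (Pi.single 0 1) j
    exact ⟨z, by rw [hz, pow_eq_zero_of_le hj hX0]; rfl⟩
  refine ⟨HeisExt f, inferInstance, HeisExt.finite f, HeisExt.gen f,
    HeisExt.emb f ⟨Pi.single 0 1, 0⟩, HeisExt.isPGroup hB (HeisExt.ofIsometry_pow_eq_one hpow),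
    HeisExt.relators_central hB hpow _, ?_, ?_, ?_⟩
  · intro j hj
    obtain ⟨j, rfl⟩ := Nat.exists_eq_add_of_lt hj
    obtain ⟨z, hz⟩ := hz (n + 1 + j) (by omega)
    rw [engel_succ, hz, comm_eq_one_of_mem_center (HeisExt.emb_mem_center z)]
  · intro j hj
    obtain ⟨z, hz⟩ := hz j hj
    rw [hz, comm_eq_one_of_mem_center (HeisExt.emb_mem_center z)]
  · intro i h
    obtain ⟨z, hz⟩ := HeisExt.engel_eq (hX := hX) (Pi.single 0 1) n
    rw [hz, HeisExt.comm_emb hB, hX1, ← map_zpow] at h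
    have h1 : ((⟨0, 2 * B ((shift n ^ n) (Pi.single 0 1)) (Pi.single 0 1)⟩ : Heis B) ^ i).cen = 0 :=
      congrArg Heis.cen (HeisExt.emb_injective f (h.trans (map_one _).symm))
    -- The central coordinate of [c_n, y] is 2(-1)^n = -2, nonzero modulo an odd prime.
    rw [Heis.zpow_cen_of_vec_eq_zero, show B ((shift n ^ n) (Pi.single 0 1)) (Pi.single 0 1) = _ from
      signForm_shift_pow_self n, hn.neg_one_pow, zsmul_eq_mul] at h1
    exact (ZMod.intCast_zmod_eq_zero_iff_dvd _ _).1
      ((mul_eq_zero.1 h1).resolve_right (mul_ne_zero h2 (neg_ne_zero.2 one_ne_zero)))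

/-! ### The free pro-`p` group and the universal property of `Gk`. -/

section Profinite

variable {p k : ℕ}

lemma exists_pIndexNormal_le (hp : p.Prime) (I : Finset (PIndexNormal p)) :
    ∃ N : PIndexNormal p, ∀ M ∈ I, N.1 ≤ M.1 := by
  classical
  induction I using Finset.induction_on with
  | empty => exact ⟨⟨⊤, inferInstance, 0, by simp⟩, by simp⟩
  | insert M I _ ih =>
    obtain ⟨N, hN⟩ := ih
    have h1 := N.2.1
    have h2 := M.2.1
    obtain ⟨a, ha⟩ := N.2.2
    obtain ⟨b, hb⟩ := M.2.2
    refine ⟨⟨N.1 ⊓ M.1, inferInstance, ?_⟩, ?_⟩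
    · have hdvd : (N.1 ⊓ M.1).index ∣ p ^ (a + b) := by
        rw [← Subgroup.relIndex_mul_index (inf_le_right : N.1 ⊓ M.1 ≤ M.1), pow_add, ← ha, ← hb,
          Subgroup.inf_relIndex_right]
        exact mul_dvd_mul_right (Subgroup.relIndex_dvd_index_of_normal _ _) _
      obtain ⟨c, -, hc⟩ := (Nat.dvd_prime_pow hp).1 hdvd
      exact ⟨c, hc⟩
    · intro M' hM'
      rcases Finset.mem_insert.1 hM' with rfl | h
      · exact inf_le_right
      · exact inf_le_left.trans (hN M' h)

/-- The abstract free group is dense in the free pro-`p` group. -/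
lemma dense_range_ofFree (hp : p.Prime) : Dense (Set.range (FreeProP.ofFree p)) := by
  rw [dense_iff_inter_open]
  rintro U hU ⟨f, hf⟩
  obtain ⟨V, hV, rfl⟩ := isOpen_induced_iff.1 hU
  obtain ⟨I, u, hu, hsub⟩ := isOpen_pi_iff.1 hV f.1 hf
  obtain ⟨N, hN⟩ := exists_pIndexNormal_le hp I
  obtain ⟨w, hw⟩ := QuotientGroup.mk_surjective (s := N.1) (f.1 N)
  refine ⟨FreeProP.ofFree p w, hsub fun M hM => ?_, w, rfl⟩
  have h1 : PQuot.mk p M w = f.1 M := by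
    rw [← f.2 N M (hN M hM), ← hw]
    rfl
  change PQuot.mk p M w ∈ u M
  rw [h1]
  exact (hu M hM).2

/-- The homomorphism from the abstract free group to the free pro-`p` group. -/
def FreeProP.ofFreeHom (p : ℕ) : FreeGroup (Fin 2) →* FreeProP p where
  toFun := FreeProP.ofFree p
  map_one' := rfl
  map_mul' _ _ := rfl

/-- The universal property of the free pro-`p` group. -/
lemma FreeProP.exists_lift (hp : p.Prime) {P : Type*} [Group P] [Finite P] (hP : IsPGroup p P)
    (a b : P) : ∃ ψ : FreeProP p →* P, ψ (FreeProP.x p) = a ∧ ψ (FreeProP.y p) = b ∧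
      ∀ S : Set P, IsClosed (ψ ⁻¹' S) := by
  have := Fact.mk hp
  let φ : FreeGroup (Fin 2) →* P := FreeGroup.lift ![a, b]
  let N : PIndexNormal p := ⟨φ.ker, inferInstance, by
    rw [Subgroup.index_ker]
    exact (IsPGroup.iff_card.1 (hP.to_subgroup φ.range))⟩
  let ev : FreeProP p →* PQuot p N :=
    { toFun := fun f => f.1 N
      map_one' := rfl
      map_mul' := fun _ _ => rfl }
  have hev : Continuous ev := (continuous_apply N).comp continuous_subtype_val
  let q : PQuot p N →* P := QuotientGroup.kerLift φ
  refine ⟨q.comp ev, ?_, ?_, fun S => ?_⟩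
  · change φ (FreeGroup.of 0) = a
    simp [φ]
  · change φ (FreeGroup.of 1) = b
    simp [φ]
  · rw [MonoidHom.coe_comp, Set.preimage_comp]
    exact (isClosed_discrete _).preimage hev

lemma relators_subset_R : relators p k (FreeProP.x p) (FreeProP.y p) ⊆ R p k :=
  Subgroup.subset_normalClosure.trans (Subgroup.le_topologicalClosure _)

lemma pow_mem_N {r : FreeProP p} (hr : r ∈ R p k) : r ^ p ∈ N p k :=
  Subgroup.le_topologicalClosure _ (Subgroup.mem_sup_right (Subgroup.subset_closure ⟨r, hr, rfl⟩))

lemma commutator_mem_N {r : FreeProP p} (hr : r ∈ R p k) (f : FreeProP p) : ⁅r, f⁆ ∈ N p k :=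
  Subgroup.le_topologicalClosure _
    (Subgroup.mem_sup_left (Subgroup.commutator_mem_commutator hr (Subgroup.mem_top f)))

lemma Gk.relators_central : ∀ r ∈ relators p k (Gk.x p k) (Gk.y p k),
    r ∈ Subgroup.center (Gk p k) ∧ r ^ p = 1 := by
  have h := image_relators p k (QuotientGroup.mk' (N p k)) (FreeProP.x p) (FreeProP.y p)
  change _ = relators p k (Gk.x p k) (Gk.y p k) at h
  rw [← h]
  rintro _ ⟨r, hr, rfl⟩
  have hrR := relators_subset_R hr
  constructor
  · rw [Subgroup.mem_center_iff]
    intro g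
    obtain ⟨g, rfl⟩ := QuotientGroup.mk'_surjective (N p k) g
    rw [eq_comm, ← commutatorElement_eq_one_iff_mul_comm, ← map_commutatorElement]
    exact (QuotientGroup.eq_one_iff _).2 (commutator_mem_N hrR g)
  · rw [← map_pow]
    exact (QuotientGroup.eq_one_iff _).2 (pow_mem_N hrR)

/-- The universal property of `G_k` with respect to finite `p`-groups. -/
lemma Gk.exists_lift (hp : p.Prime) {P : Type*} [Group P] [Finite P] (hP : IsPGroup p P)
    {a b : P} (hab : ∀ r ∈ relators p k a b, r ∈ Subgroup.center P ∧ r ^ p = 1) :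
    ∃ φ : Gk p k →* P, φ (Gk.x p k) = a ∧ φ (Gk.y p k) = b := by
  obtain ⟨ψ, hx, hy, hψ⟩ := FreeProP.exists_lift hp hP a b
  -- These are the central elements killed by `p`. Preimages under `ψ` are closed, so `ψ` sends R_k
  -- into `Ω` and then kills N_k, topological closures included.
  let Ω : Subgroup P :=
    { carrier := {c | c ∈ Subgroup.center P ∧ c ^ p = 1}
      mul_mem' := fun {c d} hc hd => ⟨mul_mem hc.1 hd.1, by
        have : Commute c d := Subgroup.mem_center_iff.1 hd.1 c
        rw [this.mul_pow, hc.2, hd.2, one_mul]⟩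
      one_mem' := ⟨one_mem _, one_pow p⟩
      inv_mem' := fun {c} hc => ⟨inv_mem hc.1, by rw [inv_pow, hc.2, inv_one]⟩ }
  have hΩ : Ω.Normal := ⟨fun c hc g => by
    rwa [Subgroup.mem_center_iff.1 hc.1 g, mul_inv_cancel_right]⟩
  have hR : R p k ≤ Ω.comap ψ := by
    have hnormal := hΩ.comap ψ
    refine Subgroup.topologicalClosure_minimal _ (Subgroup.normalClosure_le_normal ?_) (hψ Ω)
    intro r hr
    have h1 : ψ r ∈ relators p k a b := by
      rw [← hx, ← hy, ← image_relators]
      exact ⟨r, hr, rfl⟩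
    exact hab _ h1
  have hN : N p k ≤ ψ.ker := by
    refine Subgroup.topologicalClosure_minimal _ (sup_le ?_ ?_) (hψ {1})
    · rw [Subgroup.commutator_le]
      intro r hr f _
      rw [MonoidHom.mem_ker, map_commutatorElement, commutatorElement_eq_one_iff_mul_comm]
      exact (Subgroup.mem_center_iff.1 (hR hr).1 _).symm
    · refine (Subgroup.closure_le _).2 ?_
      rintro _ ⟨r, hr, rfl⟩
      exact (map_pow ψ r p).trans (hR hr).2
  exact ⟨QuotientGroup.lift (N p k) ψ hN, hx, hy⟩

lemma Gk.isCentralCover (hp : p.Prime) (hodd : Odd p) :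
    IsCentralCover p k (Gk.x p k) (Gk.y p k) := by
  refine ⟨?_, fun r hr => (Gk.relators_central r hr).1, fun r hr => (Gk.relators_central r hr).2⟩
  -- The abstract subgroup `D` is itself a central cover, hence finite. Its preimage is a finite
  -- union of closed cosets of N_k containing a dense subset, so it is everything.
  set D := Subgroup.closure {Gk.x p k, Gk.y p k} with hD
  let x' : D := ⟨Gk.x p k, Subgroup.subset_closure (Or.inl rfl)⟩
  let y' : D := ⟨Gk.y p k, Subgroup.subset_closure (Or.inr rfl)⟩
  have hrel : ∀ r ∈ relators p k x' y', (r : Gk p k) ∈ relators p k (Gk.x p k) (Gk.y p k) := by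
    intro r hr
    have h := image_relators p k D.subtype x' y'
    rw [show relators p k (Gk.x p k) (Gk.y p k) = _ from h.symm]
    exact ⟨r, hr, rfl⟩
  have hcover : IsCentralCover p k x' y' := by
    refine ⟨?_, fun r hr => ?_, fun r hr => Subtype.ext (Gk.relators_central _ (hrel r hr)).2⟩
    · have h := Subgroup.closure_closure_coe_preimage (k := {Gk.x p k, Gk.y p k})
      rw [← h]
      congr 1
      ext a
      simp [x', y', Subtype.ext_iff]
    · exact Subgroup.mem_center_iff.2 fun g => Subtype.ext
        (Subgroup.mem_center_iff.1 (Gk.relators_central _ (hrel r hr)).1 g)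
  have hfin : Finite D := hcover.finite hodd
  let q := QuotientGroup.mk' (N p k)
  have hclosed : IsClosed (q ⁻¹' (D : Set (Gk p k))) := by
    have hNclosed : IsClosed (N p k : Set (FreeProP p)) := Subgroup.isClosed_topologicalClosure _
    have hfib : ∀ d : Gk p k, IsClosed (q ⁻¹' {d}) := by
      intro d
      obtain ⟨g, rfl⟩ := QuotientGroup.mk'_surjective (N p k) d
      have : q ⁻¹' {q g} = (fun f => g⁻¹ * f) ⁻¹' (N p k : Set (FreeProP p)) := by
        ext f
        rw [Set.mem_preimage, Set.mem_singleton_iff, eq_comm]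
        exact QuotientGroup.eq
      change IsClosed (q ⁻¹' {q g})
      rw [this]
      exact hNclosed.preimage (continuous_const_mul _)
    rw [← Set.biUnion_preimage_singleton]
    exact (Set.toFinite (D : Set (Gk p k))).isClosed_biUnion fun d _ => hfib d
  have hrange : Set.range (FreeProP.ofFree p) ⊆ q ⁻¹' (D : Set (Gk p k)) := by
    have h : ((q.comp (FreeProP.ofFreeHom p)).range) ≤ D := by
      rw [MonoidHom.range_eq_map, ← FreeGroup.closure_range_of, MonoidHom.map_closure,
        Subgroup.closure_le]
      rintro _ ⟨_, ⟨i, rfl⟩, rfl⟩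
      fin_cases i
      · exact Subgroup.subset_closure (Or.inl rfl)
      · exact Subgroup.subset_closure (Or.inr rfl)
    rintro _ ⟨w, rfl⟩
    exact h ⟨w, rfl⟩
  have huniv := (dense_range_ofFree hp).closure_eq ▸ hclosed.closure_subset_iff.2 hrange
  rw [eq_top_iff]
  intro g _
  obtain ⟨f, rfl⟩ := QuotientGroup.mk'_surjective (N p k) g
  exact huniv (Set.mem_univ f)

end Profinite

/-! ### Exact class and exact orders of the factors. -/

namespace IsCentralCover

/-- Descending induction from the trivial term p^k. It reduces testing a whole term under a
homomorphism to the elements c_j and [c_j, y]. -/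
lemma lowerCentralSeries_le {p k : ℕ} {G : Type*} [Group G] {x y : G} (h : IsCentralCover p k x y)
    (hp : p.Prime) (hodd : Odd p) {n : ℕ} (hn : 1 ≤ n) (L : Subgroup G)
    (hc : ∀ j, n ≤ j → engel y x j ∈ L) (hz : ∀ j, n ≤ j + 1 → comm (engel y x j) y ∈ L) :
    (⊤ : Subgroup G).lowerCentralSeries n ≤ L := by
  have key : ∀ r n, 1 ≤ n → p ^ k ≤ n + r → (∀ j, n ≤ j → engel y x j ∈ L) →
      (∀ j, n ≤ j + 1 → comm (engel y x j) y ∈ L) →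
      (⊤ : Subgroup G).lowerCentralSeries n ≤ L := by
    intro r
    induction r with
    | zero =>
      intro n _ hr _ _
      refine (Subgroup.lowerCentralSeries_antitone _ hr).trans ?_
      rw [h.lowerCentralSeries_eq_bot hp hodd]
      exact bot_le
    | succ r ih =>
      intro n hn hr hc hz
      have hnext := ih (n + 1) (by omega) (by omega) (fun j hj => hc j (by omega))
        (fun j hj => hz j (by omega))
      obtain ⟨i, rfl | rfl⟩ : ∃ i, n = 2 * i + 1 ∨ n = 2 * i + 2 := ⟨(n - 1) / 2, by omega⟩
      · rw [h.lowerCentralSeries_odd hp hodd]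
        refine sup_le ((Subgroup.closure_le _).2 ?_) hnext
        rintro _ rfl
        exact hc _ le_rfl
      · rw [h.lowerCentralSeries_even hp hodd]
        refine sup_le ((Subgroup.closure_le _).2 ?_) hnext
        rintro _ (rfl | rfl)
        · exact hc _ le_rfl
        · exact hz _ le_rfl
  exact key (p ^ k) n hn (by omega) hc hz

end IsCentralCover

namespace Gk

variable {p k : ℕ}

/-- The factor `g` covers both kinds of factor group: a power of the second generator, or 1 as a
zeroth power. -/
lemma dvd_of_engel_zpow_mul_mem (hp : p.Prime) (hodd : Odd p) {d : ℕ} (hd : d + 1 ≤ p ^ k)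
    {i : ℤ} {g : Gk p k}
    (hg : ∃ j : ℕ, ∃ l : ℤ, g = comm (engel (Gk.y p k) (Gk.x p k) j) (Gk.y p k) ^ l)
    (h : engel (Gk.y p k) (Gk.x p k) d ^ i * g ∈
      (⊤ : Subgroup (Gk p k)).lowerCentralSeries (d + 1)) : (p : ℤ) ∣ i := by
  obtain ⟨P, _, _, a, b, C, hP, hrel, hC1, hC2, hC3⟩ := exists_group_detecting_engel hp hodd hd
  obtain ⟨φ, rfl, rfl⟩ := Gk.exists_lift hp hP hrel
  have hle := (Gk.isCentralCover (k := k) hp hodd).lowerCentralSeries_le hp hodd (n := d + 1)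
    (by omega) (C.comap φ)
    (fun j hj => by rw [Subgroup.mem_comap, map_engel]; exact hC1 j hj)
    (fun j _ => by rw [Subgroup.mem_comap, map_comm, map_engel]; exact hC2 j)
  obtain ⟨j, l, rfl⟩ := hg
  have h1 := hle h
  rw [Subgroup.mem_comap, map_mul, map_zpow, map_zpow, map_comm, map_engel, map_engel] at h1
  exact hC3 i ((Subgroup.mul_mem_cancel_right C (zpow_mem (hC2 j) l)).1 h1)

lemma dvd_of_comm_zpow_mem (hp : p.Prime) (hodd : Odd p) {n : ℕ} (hn : Odd n) (hd : n + 1 ≤ p ^ k)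
    {i : ℤ} (h : comm (engel (Gk.y p k) (Gk.x p k) n) (Gk.y p k) ^ i ∈
      (⊤ : Subgroup (Gk p k)).lowerCentralSeries (n + 2)) : (p : ℤ) ∣ i := by
  obtain ⟨P, _, _, a, b, hP, hrel, h1, h2, h3⟩ := exists_group_detecting_comm hp hodd hn hd
  obtain ⟨φ, rfl, rfl⟩ := Gk.exists_lift hp hP hrel
  have hle := (Gk.isCentralCover (k := k) hp hodd).lowerCentralSeries_le hp hodd (n := n + 2)
    (by omega) φ.ker
    (fun j hj => by rw [MonoidHom.mem_ker, map_engel]; exact h1 j hj)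
    (fun j hj => by rw [MonoidHom.mem_ker, map_comm, map_engel]; exact h2 j (by omega))
  have h4 := hle h
  rw [MonoidHom.mem_ker, map_zpow, map_comm, map_engel] at h4
  exact h3 i h4

lemma nilpotencyClass_eq (hp : p.Prime) (hodd : Odd p) :
    ∃ _ : Group.IsNilpotent (Gk p k), Group.nilpotencyClass (Gk p k) = p ^ k := by
  have hG := Gk.isCentralCover (k := k) hp hodd
  have hnil := hG.isNilpotent hp hodd
  refine ⟨hnil, le_antisymm
    (Subgroup.lowerCentralSeries_eq_bot_iff_nilpotencyClass_le.1
      (hG.lowerCentralSeries_eq_bot hp hodd)) ?_⟩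
  by_contra! hlt
  have hpos : 0 < p ^ k := pow_pos hp.pos k
  have hbot := Subgroup.lowerCentralSeries_eq_bot_iff_nilpotencyClass_le.2
    (show Group.nilpotencyClass (Gk p k) ≤ p ^ k - 1 by omega)
  have hmem := engel_mem_lowerCentralSeries (Gk.y p k) (Gk.x p k) (p ^ k - 1)
  rw [hbot, Subgroup.mem_bot] at hmem
  -- The last detectable index is p^k - 1; if c_{p^k - 1} were trivial, `p` would divide 1.
  have hdvd := dvd_of_engel_zpow_mul_mem (k := k) (d := p ^ k - 1) hp hodd (by omega)
    (i := 1) (g := 1) ⟨0, 0, (zpow_zero _).symm⟩ (by rw [hmem, one_zpow, one_mul]; exact one_mem _)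
  exact hp.one_lt.ne' (by exact_mod_cast Int.eq_one_of_dvd_one (by positivity) hdvd)

lemma nonempty_abelianization_mulEquiv (hp : p.Prime) (hodd : Odd p) :
    Nonempty ((Gk p k ⧸ gamma (Gk p k) 2) ≃* Cyc (p ^ (k + 1)) × Cyc (p ^ 2)) := by
  have hG := Gk.isCentralCover (k := k) hp hodd
  have := Fact.mk hp
  have : NeZero p := ⟨hp.ne_zero⟩
  -- An abelian test group in which x^{p^k} and y^p are still nontrivial, of order `p`.
  let A := Cyc (p ^ (k + 1)) × Cyc (p ^ 2)
  let a : A := (Multiplicative.ofAdd 1, 1)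
  let b : A := (1, Multiplicative.ofAdd 1)
  have hab : ∀ i j : ℤ, a ^ i * b ^ j =
      (Multiplicative.ofAdd (i : ZMod (p ^ (k + 1))), Multiplicative.ofAdd (j : ZMod (p ^ 2))) := by
    intro i j
    refine Prod.ext ?_ ?_
    · change Multiplicative.ofAdd (1 : ZMod (p ^ (k + 1))) ^ i * 1 ^ j = _
      rw [one_zpow, mul_one, ← ofAdd_zsmul, zsmul_one]
    · change 1 ^ i * Multiplicative.ofAdd (1 : ZMod (p ^ 2)) ^ j = _
      rw [one_zpow, one_mul, ← ofAdd_zsmul, zsmul_one]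
  have hapow : a ^ p ^ (k + 1) = 1 := by
    have h := hab (p ^ (k + 1) : ℕ) 0
    rw [zpow_zero, mul_one, zpow_natCast, Int.cast_natCast, ZMod.natCast_self, Int.cast_zero] at h
    exact h
  have hbpow : b ^ p ^ 2 = 1 := by
    have h := hab 0 (p ^ 2 : ℕ)
    rw [zpow_zero, one_mul, zpow_natCast, Int.cast_natCast, ZMod.natCast_self, Int.cast_zero] at h
    exact h
  have hP : IsPGroup p A := IsPGroup.of_card (n := k + 1 + 2) (by
    rw [Nat.card_prod, pow_add _ (k + 1) 2, Nat.card_congr Multiplicative.toAdd,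
      Nat.card_congr Multiplicative.toAdd, Nat.card_zmod, Nat.card_zmod])
  obtain ⟨φ, hφx, hφy⟩ := Gk.exists_lift (k := k) (a := a) (b := b) hp hP (by
    refine fun r hr => ⟨Subgroup.mem_center_iff.2 fun g => mul_comm g r, ?_⟩
    rcases hr with (rfl | rfl) | ⟨i, -, -, rfl⟩
    · rw [← pow_mul, ← pow_succ, hapow]
    · rw [← pow_mul, ← sq, hbpow]
    · rw [comm_eq_one_iff.2 (mul_comm _ _), one_pow])
  let q := QuotientGroup.mk' (gamma (Gk p k) 2)
  refine nonempty_mulEquiv_cyc_prod (a := q (Gk.x p k)) (b := q (Gk.y p k)) ?_ ?_ ?_ ?_ ?_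
  · rw [← comm_eq_one_iff, ← map_comm]
    exact (QuotientGroup.eq_one_iff _).2
      (comm_mem_lowerCentralSeries (n := 0) (Subgroup.mem_top _) _)
  · rw [← Set.image_pair, ← MonoidHom.map_closure, hG.closure_eq, ← MonoidHom.range_eq_map,
      MonoidHom.range_eq_top]
    exact QuotientGroup.mk'_surjective _
  · rw [← map_pow, pow_succ, pow_mul, hG.pow_eq_one _ (Or.inl (Or.inl rfl)), map_one]
  · rw [← map_pow, sq, pow_mul, hG.pow_eq_one _ (Or.inl (Or.inr rfl)), map_one]
  · intro i j hij
    rw [← map_zpow, ← map_zpow, ← map_mul] at hij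
    have hmem := (QuotientGroup.eq_one_iff _).1 hij
    have hle : gamma (Gk p k) 2 ≤ φ.ker := by
      change (⊤ : Subgroup (Gk p k)).lowerCentralSeries 1 ≤ φ.ker
      rw [Subgroup.lowerCentralSeries_succ, Subgroup.commutator_le]
      intro g _ g' _
      rw [MonoidHom.mem_ker, map_commutatorElement, commutatorElement_eq_one_iff_mul_comm]
      exact mul_comm _ _
    have h1 := hle hmem
    rw [MonoidHom.mem_ker, map_mul, map_zpow, map_zpow, hφx, hφy, hab] at h1
    exact ⟨(ZMod.intCast_zmod_eq_zero_iff_dvd _ _).1 (congrArg Prod.fst h1),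
      (ZMod.intCast_zmod_eq_zero_iff_dvd _ _).1 (congrArg Prod.snd h1)⟩

end Gk

end HausdorffSpectra

end

open HausdorffSpectra in
theorem proposition6p1 (p k : ℕ) (hp : p.Prime) (hodd : p ≠ 2) (hk : 1 ≤ k) :
    -- nilpotent of class `p ^ k`
    (∃ _ : Group.IsNilpotent (Gk p k), Group.nilpotencyClass (Gk p k) = p ^ k) ∧
    -- the first factor
    gamma (Gk p k) 1 = ⊤ ∧
    gamma (Gk p k) 1 = Subgroup.closure {Gk.x p k, Gk.y p k} ⊔ gamma (Gk p k) 2 ∧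
    Nonempty ((Gk p k ⧸ gamma (Gk p k) 2) ≃* Cyc (p ^ (k + 1)) × Cyc (p ^ 2)) ∧
    -- the remaining factors
    ∀ i : ℕ, 1 ≤ i → i ≤ (p ^ k - 1) / 2 →
      gamma (Gk p k) (2 * i) =
        Subgroup.closure {engel (Gk.y p k) (Gk.x p k) (2 * i - 1)} ⊔ gamma (Gk p k) (2 * i + 1) ∧
      gamma (Gk p k) (2 * i + 1) =
        Subgroup.closure {engel (Gk.y p k) (Gk.x p k) (2 * i),
          comm (engel (Gk.y p k) (Gk.x p k) (2 * i - 1)) (Gk.y p k)} ⊔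
            gamma (Gk p k) (2 * i + 2) ∧
      Nonempty (gammaFactor (Gk p k) (2 * i) ≃* Cyc p) ∧
      Nonempty (gammaFactor (Gk p k) (2 * i + 1) ≃* Cyc p × Cyc p) := by
  have hodd' : Odd p := hp.odd_of_ne_two hodd
  have hG := Gk.isCentralCover (k := k) hp hodd'
  refine ⟨Gk.nilpotencyClass_eq hp hodd', rfl, ?_, Gk.nonempty_abelianization_mulEquiv hp hodd', ?_⟩
  · rw [hG.closure_eq, top_sup_eq]; rfl
  intro i hi hi'
  obtain ⟨i, rfl⟩ := Nat.exists_eq_add_of_le' hi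
  have h1 := hG.lowerCentralSeries_odd hp hodd' i
  have h2 := hG.lowerCentralSeries_even hp hodd' i
  refine ⟨h1, h2, ?_, ?_⟩
  · refine nonempty_quotient_mulEquiv_cyc h1 (hG.engel_pow_eq_one hodd' (2 * i)) fun l hl => ?_
    refine Gk.dvd_of_engel_zpow_mul_mem hp hodd' (d := 2 * i + 1) (k := k) (g := 1) (by omega)
      ⟨0, 0, (zpow_zero _).symm⟩ ?_
    rw [mul_one]
    exact hl
  · have hz := hG.comm_engel_mem_center hodd' (2 * i + 1) 0
    refine nonempty_quotient_mulEquiv_cyc_prod h2 (Subgroup.mem_center_iff.1 hz _)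
      (hG.engel_pow_eq_one hodd' (2 * i + 1)) (hG.comm_engel_pow_eq_one hodd' (2 * i + 1))
      fun l m hlm => ?_
    -- The exponent of c_{2i+2} is detected first, whatever the other generator does; its `p`-th
    -- power being trivial, only the other generator remains.
    have hl := Gk.dvd_of_engel_zpow_mul_mem hp hodd' (d := 2 * i + 2) (k := k) (by omega)
      ⟨_, _, rfl⟩ hlm
    refine ⟨hl, Gk.dvd_of_comm_zpow_mem hp hodd' (n := 2 * i + 1) (k := k) ⟨i, rfl⟩ (by omega) ?_⟩
    obtain ⟨c, rfl⟩ := hl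
    rw [zpow_mul, zpow_natCast, hG.engel_pow_eq_one hodd' (2 * i + 1), one_zpow, one_mul] at hlm
    exact hlm
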